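/- Let $E$ be an elliptic curve over an algebraically closed field of characteristic $0$, let $K$ be its field of rational functions, and let $\mathbb Z[E]^-$ be the quotient of the free abelian group $\mathbb Z[E]$ on the points of $E$ by the subgroup generated by all $[\xi]+[-\xi]$, $\xi\in E$. Let $\beta\colon \Lambda^2 K^\times\to\mathbb Z[E]^-$ be the homomorphism given by $\beta(f\wedge g)=\sum_{i,j} n_i m_j\,[x_i-y_j]$, where $\sum_i n_i[x_i]$ and $\sum_j m_j[y_j]$ are the divisors of $f$ and $g$. Let $\mathcal R\subset\mathbb Z[E]^-$ be the subgroup generated by the elements $\beta(f\wedge(1-f))$ for all $f\in K\setminus\{0,1\}$. Then $\mathcal R$ is generated by the elements $\beta(f\wedge(1-f))$ with $f\in K\setminus\{0,1\}$ and $\deg f\le 3$, where $\deg f$ is the number of zeros of $f$ counted with multiplicity. -/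

import Mathlib

namespace EllipticBloch

open Polynomial nonZeroDivisors
open WeierstrassCurve.Affine

variable {F : Type*} [Field F] {W : WeierstrassCurve.Affine F}

instance isNoetherianRing_coordinateRing : IsNoetherianRing W.CoordinateRing :=
  inferInstanceAs (IsNoetherianRing (F[X][X] ⧸ _))

instance finite_coordinateRing : Module.Finite F[X] W.CoordinateRing :=
  .of_basis (CoordinateRing.basis W)

lemma xyIdeal_isMaximal {x y : F} (h : W.Equation x y) :
    (CoordinateRing.XYIdeal W x (C y)).IsMaximal := by
  have e := CoordinateRing.quotientXYIdealEquiv (W' := W) (x := x) (y := C y) h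
  exact Ideal.Quotient.maximal_of_isField _ (e.toMulEquiv.isField (Field.toIsField F))

lemma xyIdeal_ne_bot (x y : F) : CoordinateRing.XYIdeal W x (C y) ≠ ⊥ := fun h0 => by
  have : CoordinateRing.XClass W x ∈ CoordinateRing.XYIdeal W x (C y) :=
    Ideal.subset_span (by simp)
  rw [h0, Ideal.mem_bot] at this
  exact CoordinateRing.XClass_ne_zero x this

/-- Over an algebraically closed field every nonzero prime ideal of the affine coordinate ring is
the ideal of an affine point. -/
lemma exists_eq_xyIdeal [IsAlgClosed F] [W.IsElliptic] (P : Ideal W.CoordinateRing)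
    [hP : P.IsPrime] (h0 : P ≠ ⊥) :
    ∃ x y : F, W.Nonsingular x y ∧ P = CoordinateRing.XYIdeal W x (C y) := by
  have hc : P.comap (algebraMap F[X] W.CoordinateRing) ≠ ⊥ := fun h =>
    h0 (Ideal.eq_bot_of_comap_eq_bot h)
  obtain ⟨g, hg⟩ := IsPrincipalIdealRing.principal (P.comap (algebraMap F[X] W.CoordinateRing))
  have hg0 : g ≠ 0 := by
    rintro rfl
    exact hc (by rw [hg]; simp)
  have hgp : Irreducible g := by
    have : (P.comap (algebraMap F[X] W.CoordinateRing)).IsPrime := inferInstance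
    rw [hg] at this
    exact ((Ideal.span_singleton_prime hg0).mp this).irreducible
  obtain ⟨x, hx⟩ := IsAlgClosed.exists_root g
    (by rw [IsAlgClosed.degree_eq_one_of_irreducible F hgp]; exact one_ne_zero)
  have hxP : CoordinateRing.XIdeal W x ≤ P := by
    have : X - C x ∈ P.comap (algebraMap F[X] W.CoordinateRing) := by
      rw [hg]
      exact Ideal.mem_span_singleton.mpr
        ((irreducible_X_sub_C x).dvd_symm hgp (dvd_iff_isRoot.mpr hx))
    exact (Ideal.span_singleton_le_iff_mem _).mpr this
  obtain ⟨y, hy⟩ := IsAlgClosed.exists_root (W.polynomial.map (evalRingHom x)) (by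
    rw [monic_polynomial.degree_map, degree_polynomial]; exact two_ne_zero)
  have hy' : W.Equation x y := by
    rwa [IsRoot.def, map_evalRingHom_eval] at hy
  have hns := equation_iff_nonsingular.mp hy'
  rw [← CoordinateRing.XYIdeal_neg_mul hns, hP.mul_le] at hxP
  rcases hxP with h | h
  · exact ⟨x, W.negY x y, (nonsingular_neg ..).mpr hns,
      ((xyIdeal_isMaximal ((nonsingular_neg ..).mpr hns).1).eq_of_le hP.ne_top h).symm⟩
  · exact ⟨x, y, hns, ((xyIdeal_isMaximal hy').eq_of_le hP.ne_top h).symm⟩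

/-- In a local domain, an ideal dividing a nonzero principal ideal is principal. -/
lemma isPrincipal_of_mul_eq_span {A : Type*} [CommRing A] [IsDomain A] [IsLocalRing A]
    (J I : Ideal A) {t : A} (ht : t ≠ 0) (h : J * I = Ideal.span {t}) : I.IsPrincipal := by
  refine Ideal.IsPrincipal.of_finite_maximals_of_isUnit
    ((Set.finite_singleton (IsLocalRing.maximalIdeal A)).subset
      fun I hI => IsLocalRing.eq_maximalIdeal hI) ?_
  refine isUnit_of_mul_isUnit_right (x := (J : FractionalIdeal A⁰ (FractionRing A))) ?_
  rw [← FractionalIdeal.coeIdeal_mul, h]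
  exact .of_mul_eq_one _ (FractionalIdeal.coe_ideal_span_singleton_mul_inv _ ht)

lemma isDiscreteValuationRing_localization [IsAlgClosed F] [W.IsElliptic]
    (P : Ideal W.CoordinateRing) (h0 : P ≠ ⊥) (hP : P.IsPrime) :
    IsDiscreteValuationRing (Localization.AtPrime P) := by
  obtain ⟨x, y, h, hxy⟩ := exists_eq_xyIdeal P h0
  refine ((IsDiscreteValuationRing.TFAE (Localization.AtPrime P)
    (IsLocalization.AtPrime.not_isField _ h0 _)).out 0 4).mpr ?_
  have hmul := congr_arg (Ideal.map (algebraMap _ (Localization.AtPrime P)))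
    (CoordinateRing.XYIdeal_neg_mul h)
  rw [← hxy, Ideal.map_mul, Localization.AtPrime.map_eq_maximalIdeal, CoordinateRing.XIdeal,
    Ideal.map_span, Set.image_singleton] at hmul
  have ht : algebraMap _ (Localization.AtPrime P) (CoordinateRing.XClass W x) ≠ 0 :=
    (map_ne_zero_iff _ (IsLocalization.injective _ P.primeCompl_le_nonZeroDivisors)).mpr
      (CoordinateRing.XClass_ne_zero x)
  exact isPrincipal_of_mul_eq_span _ _ ht hmul

instance isDedekindDomain_coordinateRing [IsAlgClosed F] [W.IsElliptic] :
    IsDedekindDomain W.CoordinateRing :=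
  have : IsDedekindDomainDvr W.CoordinateRing :=
    { is_dvr_at_nonzero_prime := isDiscreteValuationRing_localization }
  inferInstance


/-- The degree `∑ nᵢ` of a divisor `∑ nᵢ [xᵢ]`. -/
noncomputable def divisorDegree {X : Type*} : (X →₀ ℤ) →+ ℤ :=
  Finsupp.liftAddHom fun _ => AddMonoidHom.id ℤ

/-- The order of the pole at the point at infinity of a nonzero regular function `a` on the affine
part of the curve. If `a = p(X) + q(X) Y`, the degree of its norm to `F[X]` is
`max (2 deg p) (2 deg q + 3)`. -/
noncomputable def poleOrder (a : W.CoordinateRing) : ℕ := (Algebra.norm F[X] a).natDegree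

/-- The order of vanishing at the point at infinity of a nonzero rational function `f = a / b`
(negative at a pole). -/
noncomputable def ordInfinity (f : W.FunctionField) : ℤ :=
  poleOrder ((IsLocalization.sec W.CoordinateRing⁰ f).2 : W.CoordinateRing) -
    poleOrder (IsLocalization.sec W.CoordinateRing⁰ f).1

lemma poleOrder_mul {a b : W.CoordinateRing} (ha : a ≠ 0) (hb : b ≠ 0) :
    poleOrder (a * b) = poleOrder a + poleOrder b := by
  rw [poleOrder, map_mul, natDegree_mul]
  · rfl
  · exact Algebra.norm_ne_zero_iff.mpr ha
  · exact Algebra.norm_ne_zero_iff.mpr hb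

lemma ordInfinity_div {a b : W.CoordinateRing} (ha : a ≠ 0) (hb : b ≠ 0) :
    ordInfinity (algebraMap _ W.FunctionField a / algebraMap _ W.FunctionField b) =
      poleOrder b - poleOrder a := by
  set f := algebraMap _ W.FunctionField a / algebraMap _ W.FunctionField b with hf
  have hinj := IsFractionRing.injective W.CoordinateRing W.FunctionField
  have hb' : algebraMap _ W.FunctionField b ≠ 0 := (map_ne_zero_iff _ hinj).mpr hb
  have ha' : algebraMap _ W.FunctionField a ≠ 0 := (map_ne_zero_iff _ hinj).mpr ha
  have h := IsLocalization.sec_spec W.CoordinateRing⁰ f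
  set s := IsLocalization.sec W.CoordinateRing⁰ f
  have h2 : (s.2 : W.CoordinateRing) ≠ 0 := nonZeroDivisors.ne_zero s.2.2
  have heq : a * s.2 = s.1 * b := by
    apply hinj
    rw [map_mul, map_mul, ← h, hf]
    field_simp
  have h1 : s.1 ≠ 0 := fun h1 => mul_ne_zero ha h2 (by rw [heq, h1, zero_mul])
  have := congr_arg poleOrder heq
  rw [poleOrder_mul ha h2, poleOrder_mul h1 hb] at this
  change (poleOrder (s.2 : W.CoordinateRing) : ℤ) - poleOrder s.1 = _
  omega

lemma exists_eq_div {f : W.FunctionField} (hf : f ≠ 0) : ∃ a b : W.CoordinateRing, a ≠ 0 ∧ b ≠ 0 ∧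
    f = algebraMap _ W.FunctionField a / algebraMap _ W.FunctionField b := by
  obtain ⟨a, b, hb, rfl⟩ := IsFractionRing.div_surjective (A := W.CoordinateRing) f
  refine ⟨a, b, ?_, nonZeroDivisors.ne_zero hb, rfl⟩
  rintro rfl
  simp at hf


lemma xyIdeal_inj {x y x' y' : F} (h : W.Nonsingular x y)
    (hI : CoordinateRing.XYIdeal W x (C y) = CoordinateRing.XYIdeal W x' (C y')) :
    x = x' ∧ y = y' := by
  have key : ∀ c : F, algebraMap F W.CoordinateRing c ∈ CoordinateRing.XYIdeal W x (C y) →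
      c = 0 := fun c hc => by
    by_contra h0
    exact (xyIdeal_isMaximal h.1).ne_top (Ideal.eq_top_of_isUnit_mem _ hc
      ((IsUnit.mk0 c h0).map _))
  have hX : CoordinateRing.XClass W x ∈ CoordinateRing.XYIdeal W x (C y) :=
    Ideal.subset_span (by simp)
  have hX' : CoordinateRing.XClass W x' ∈ CoordinateRing.XYIdeal W x (C y) :=
    hI ▸ Ideal.subset_span (by simp)
  have hY : CoordinateRing.YClass W (C y) ∈ CoordinateRing.XYIdeal W x (C y) :=
    Ideal.subset_span (by simp)
  have hY' : CoordinateRing.YClass W (C y') ∈ CoordinateRing.XYIdeal W x (C y) :=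
    hI ▸ Ideal.subset_span (by simp)
  have e : ∀ c : F, algebraMap F W.CoordinateRing c = CoordinateRing.mk W (C (C c)) :=
    fun c => rfl
  constructor
  · refine sub_eq_zero.mp (key _ ?_)
    have := sub_mem hX' hX
    rw [CoordinateRing.XClass, CoordinateRing.XClass, ← map_sub] at this
    rw [e]
    convert! this using 2
    simp only [map_sub]
    ring
  · refine sub_eq_zero.mp (key _ ?_)
    have := sub_mem hY' hY
    rw [CoordinateRing.YClass, CoordinateRing.YClass, ← map_sub] at this
    rw [e]
    convert! this using 2
    simp only [map_sub]
    ring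

/-- The maximal ideal `(X - x, Y - y)` of an affine point `(x, y)`, as a prime of height one of the
affine coordinate ring. -/
noncomputable def pointPrime {x y : F} (h : W.Nonsingular x y) :
    IsDedekindDomain.HeightOneSpectrum W.CoordinateRing where
  asIdeal := CoordinateRing.XYIdeal W x (C y)
  isPrime := (xyIdeal_isMaximal h.1).isPrime
  ne_bot := xyIdeal_ne_bot x y

lemma pointPrime_inj {x y x' y' : F} {h : W.Nonsingular x y} {h' : W.Nonsingular x' y'}
    (hp : pointPrime h = pointPrime h') : x = x' ∧ y = y' :=
  xyIdeal_inj h (congr_arg (·.asIdeal) hp)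

section Points

variable [IsAlgClosed F] [W.IsElliptic]

/-- The order of vanishing at `P` of a nonzero rational function `f`. At an affine point it is the
exponent of the maximal ideal of `P` in the factorization of the principal fractional ideal
generated by `f` over the affine coordinate ring, which is a Dedekind domain. -/
noncomputable def ord : W.Point → W.FunctionField → ℤ
  | .zero, f => ordInfinity f
  | .some _ _ h, f => FractionalIdeal.count W.FunctionField (pointPrime h)
      (FractionalIdeal.spanSingleton W.CoordinateRing⁰ f)

lemma ord_mul (P : W.Point) {f g : W.FunctionField} (hf : f ≠ 0) (hg : g ≠ 0) :
    ord P (f * g) = ord P f + ord P g := by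
  cases P with
  | zero =>
    obtain ⟨a, b, ha, hb, rfl⟩ := exists_eq_div hf
    obtain ⟨c, d, hc, hd, rfl⟩ := exists_eq_div hg
    simp only [ord]
    rw [div_mul_div_comm, ← map_mul, ← map_mul, ordInfinity_div (mul_ne_zero ha hc)
      (mul_ne_zero hb hd), ordInfinity_div ha hb, ordInfinity_div hc hd, poleOrder_mul ha hc,
      poleOrder_mul hb hd]
    push_cast
    ring
  | some x y h =>
    simp only [ord]
    rw [← FractionalIdeal.spanSingleton_mul_spanSingleton, FractionalIdeal.count_mul]
    · exact FractionalIdeal.spanSingleton_ne_zero_iff.mpr hf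
    · exact FractionalIdeal.spanSingleton_ne_zero_iff.mpr hg

/-- The multiplicities of a fractional ideal at the affine points. -/
noncomputable def affineOrd (I : FractionalIdeal W.CoordinateRing⁰ W.FunctionField) : W.Point → ℤ
  | .zero => 0
  | .some _ _ h => FractionalIdeal.count W.FunctionField (pointPrime h) I

lemma affineOrd_finite (I : FractionalIdeal W.CoordinateRing⁰ W.FunctionField) :
    (Function.support (affineOrd I)).Finite := by
  let φ : W.Point → Option (IsDedekindDomain.HeightOneSpectrum W.CoordinateRing) := fun P =>
    match P with
    | .zero => none
    | .some _ _ h => some (pointPrime h)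
  have hφ : Function.Injective φ := by
    rintro (_ | ⟨x, y, h⟩) (_ | ⟨x', y', h'⟩) hP
    · rfl
    · simp [φ] at hP
    · simp [φ] at hP
    · obtain ⟨rfl, rfl⟩ := pointPrime_inj (Option.some.inj hP)
      rfl
  have hfin := FractionalIdeal.finite_factors (K := W.FunctionField) I
  rw [Filter.eventually_cofinite] at hfin
  refine ((hfin.image some).preimage hφ.injOn).subset ?_
  rintro (_ | ⟨x, y, h⟩) hP
  · simp [affineOrd] at hP
  · exact ⟨pointPrime h, hP, rfl⟩

lemma ord_finite (f : W.FunctionField) : (Function.support fun P : W.Point => ord P f).Finite := by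
  refine ((affineOrd_finite (FractionalIdeal.spanSingleton W.CoordinateRing⁰ f)).union
    (Set.finite_singleton (0 : W.Point))).subset ?_
  rintro (_ | ⟨x, y, h⟩) hP
  · exact Or.inr rfl
  · exact Or.inl hP

/-- The divisor of a nonzero rational function, as a homomorphism to `ℤ[E]`. -/
noncomputable def divisor : Additive W.FunctionFieldˣ →+ (W.Point →₀ ℤ) where
  toFun f := Finsupp.ofSupportFinite (fun P => ord P (f.toMul : W.FunctionField)) (ord_finite _)
  map_zero' := by
    ext P
    have := ord_mul P (one_ne_zero (α := W.FunctionField)) one_ne_zero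
    rw [mul_one] at this
    change ord P (1 : W.FunctionField) = 0
    omega
  map_add' f g := by
    ext P
    exact ord_mul P f.toMul.ne_zero g.toMul.ne_zero

/-- The affine part of the divisor of a fractional ideal, as an element of `ℤ[E]`. -/
noncomputable def affineDivisor (I : FractionalIdeal W.CoordinateRing⁰ W.FunctionField) :
    W.Point →₀ ℤ := Finsupp.ofSupportFinite (affineOrd I) (affineOrd_finite I)

lemma affineDivisor_mul {I J : FractionalIdeal W.CoordinateRing⁰ W.FunctionField} (hI : I ≠ 0)
    (hJ : J ≠ 0) : affineDivisor (I * J) = affineDivisor I + affineDivisor J := by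
  ext (_ | ⟨x, y, h⟩)
  · simp [affineDivisor, affineOrd, Finsupp.ofSupportFinite_coe]
  · exact FractionalIdeal.count_mul _ _ hI hJ

lemma affineDivisor_point {x y : F} (h : W.Nonsingular x y) :
    affineDivisor ((CoordinateRing.XYIdeal W x (C y) : Ideal W.CoordinateRing) :
      FractionalIdeal W.CoordinateRing⁰ W.FunctionField) = Finsupp.single (.some x y h) 1 := by
  classical
  ext (_ | ⟨x', y', h'⟩)
  · rw [Finsupp.single_apply, if_neg (by simp)]
    rfl
  · rw [Finsupp.single_apply]
    change FractionalIdeal.count W.FunctionField (pointPrime h')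
      ((pointPrime h).asIdeal : FractionalIdeal W.CoordinateRing⁰ W.FunctionField) = _
    rw [FractionalIdeal.count_maximal]
    refine if_congr ⟨fun hp => ?_, fun hp => ?_⟩ rfl rfl
    · obtain ⟨rfl, rfl⟩ := pointPrime_inj hp
      rfl
    · cases hp
      rfl

/-- The degree of the norm to `F[X]` of an ideal. -/
noncomputable def idealDegree (I : Ideal W.CoordinateRing) : ℕ :=
  (Submodule.IsPrincipal.generator (Ideal.relNorm F[X] I)).natDegree

lemma idealDegree_eq {I : Ideal W.CoordinateRing} {g : F[X]}
    (h : Ideal.relNorm F[X] I = Ideal.span {g}) : idealDegree I = g.natDegree := by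
  refine natDegree_eq_of_degree_eq (degree_eq_degree_of_associated
    (Ideal.span_singleton_eq_span_singleton.mp ?_))
  rw [← h]
  exact Ideal.span_singleton_generator _

lemma idealDegree_mul {I J : Ideal W.CoordinateRing} (hI : I ≠ 0) (hJ : J ≠ 0) :
    idealDegree (I * J) = idealDegree I + idealDegree J := by
  rw [idealDegree_eq (I := I * J) (g := Submodule.IsPrincipal.generator (Ideal.relNorm F[X] I) *
    Submodule.IsPrincipal.generator (Ideal.relNorm F[X] J)), natDegree_mul]
  · rfl
  · rwa [Ne, ← Submodule.IsPrincipal.eq_bot_iff_generator_eq_zero, Ideal.relNorm_eq_bot_iff]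
  · rwa [Ne, ← Submodule.IsPrincipal.eq_bot_iff_generator_eq_zero, Ideal.relNorm_eq_bot_iff]
  · rw [map_mul, ← Ideal.span_singleton_mul_span_singleton, Ideal.span_singleton_generator,
      Ideal.span_singleton_generator]

lemma idealDegree_span {a : W.CoordinateRing} : idealDegree (Ideal.span {a}) = poleOrder a :=
  idealDegree_eq (by rw [Ideal.relNorm_singleton, Algebra.intNorm_eq_norm])

lemma idealDegree_pos {I : Ideal W.CoordinateRing} (hI : I ≠ ⊤) (h0 : I ≠ 0) :
    0 < idealDegree I := by
  by_contra h
  obtain ⟨c, hc⟩ := natDegree_eq_zero.mp (Nat.eq_zero_of_not_pos h)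
  have hg : Submodule.IsPrincipal.generator (Ideal.relNorm F[X] I) ≠ 0 := by
    rwa [Ne, ← Submodule.IsPrincipal.eq_bot_iff_generator_eq_zero, Ideal.relNorm_eq_bot_iff]
  have hc0 : c ≠ 0 := by
    rintro rfl
    exact hg (by rw [← hc, C_0])
  have hu : IsUnit (Submodule.IsPrincipal.generator (Ideal.relNorm F[X] I)) := by
    rw [← hc]
    exact isUnit_C.mpr (IsUnit.mk0 c hc0)
  have htop := Ideal.eq_top_of_isUnit_mem _ (Submodule.IsPrincipal.generator_mem _) hu
  exact hI ((Ideal.comap_eq_top_iff).mp (top_le_iff.mp (htop ▸ Ideal.relNorm_le_comap F[X] I)))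

lemma idealDegree_point {x y : F} (h : W.Nonsingular x y) :
    idealDegree (CoordinateRing.XYIdeal W x (C y)) = 1 := by
  have h' := (nonsingular_neg x y).mpr h
  have h1 := idealDegree_pos (xyIdeal_isMaximal h.1).ne_top (xyIdeal_ne_bot x y)
  have h2 := idealDegree_pos (xyIdeal_isMaximal h'.1).ne_top (xyIdeal_ne_bot x (W.negY x y))
  have h3 := idealDegree_mul (xyIdeal_ne_bot (W := W) x (W.negY x y)) (xyIdeal_ne_bot x y)
  rw [CoordinateRing.XYIdeal_neg_mul h, CoordinateRing.XIdeal, idealDegree_span, poleOrder] at h3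
  have h4 : Algebra.norm F[X] (CoordinateRing.XClass W x) = (X - C x) ^ 2 := by
    have := Algebra.norm_algebraMap_of_basis (CoordinateRing.basis W) (X - C x)
    rwa [Fintype.card_fin] at this
  rw [h4, natDegree_pow, natDegree_X_sub_C] at h3
  omega

lemma divisorDegree_affineDivisor {I : Ideal W.CoordinateRing} (hI : I ≠ 0) :
    divisorDegree (affineDivisor (I : FractionalIdeal W.CoordinateRing⁰ W.FunctionField)) =
      idealDegree I := by
  induction I using UniqueFactorizationMonoid.induction_on_prime with
  | h₁ => exact absurd rfl hI
  | h₂ I hu =>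
    obtain rfl := Ideal.isUnit_iff.mp hu
    rw [idealDegree_eq (g := 1) (by rw [Ideal.relNorm_top, Ideal.span_singleton_one]),
      FractionalIdeal.coeIdeal_top]
    have h1 := affineDivisor_mul (W := W) one_ne_zero one_ne_zero
    rw [mul_one, left_eq_add] at h1
    rw [h1, map_zero, natDegree_one, Nat.cast_zero]
  | h₃ I P hI0 hP ih =>
    have hprime := Ideal.isPrime_of_prime hP
    obtain ⟨x, y, h, rfl⟩ := exists_eq_xyIdeal P hP.ne_zero
    rw [FractionalIdeal.coeIdeal_mul, affineDivisor_mul, map_add, ih hI0, idealDegree_mul,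
      affineDivisor_point h, idealDegree_point h]
    · simp [divisorDegree]
    · exact hP.ne_zero
    · exact hI0
    · exact FractionalIdeal.coeIdeal_ne_zero.mpr hP.ne_zero
    · exact FractionalIdeal.coeIdeal_ne_zero.mpr hI0

lemma divisorDegree_divisor_aux {a : W.CoordinateRing} (ha : a ≠ 0) (f : W.FunctionFieldˣ)
    (hf : (f : W.FunctionField) = algebraMap _ _ a) :
    divisorDegree (divisor (Additive.ofMul f)) = 0 := by
  have h : divisor (Additive.ofMul f) = Finsupp.single (.zero : W.Point) (-(poleOrder a : ℤ)) +
      affineDivisor ((Ideal.span {a} : Ideal W.CoordinateRing) :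
        FractionalIdeal W.CoordinateRing⁰ W.FunctionField) := by
    classical
    ext (_ | ⟨x, y, h⟩)
    · have h1 := ordInfinity_div ha one_ne_zero
      rw [map_one, div_one, ← hf] at h1
      rw [Finsupp.add_apply, Finsupp.single_eq_same]
      change ordInfinity (f : W.FunctionField) = -(poleOrder a : ℤ) + 0
      simp [h1, poleOrder]
    · rw [Finsupp.add_apply, Finsupp.single_apply, if_neg (by simp),
        FractionalIdeal.coeIdeal_span_singleton, ← hf, zero_add]
      rfl
  rw [h, map_add, divisorDegree_affineDivisor, idealDegree_span]
  · simp [divisorDegree, -Finsupp.single_neg]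
  · rwa [Ne, Ideal.zero_eq_bot, Ideal.span_singleton_eq_bot]

/-- The divisor of a rational function has degree zero. -/
lemma divisorDegree_divisor (f : Additive W.FunctionFieldˣ) : divisorDegree (divisor f) = 0 := by
  have hinj := IsFractionRing.injective W.CoordinateRing W.FunctionField
  obtain ⟨a, b, ha, hb, hf⟩ := exists_eq_div f.toMul.ne_zero
  have ha' : algebraMap _ W.FunctionField a ≠ 0 := (map_ne_zero_iff _ hinj).mpr ha
  have hb' : algebraMap _ W.FunctionField b ≠ 0 := (map_ne_zero_iff _ hinj).mpr hb
  have h : f = Additive.ofMul (Units.mk0 _ ha') - Additive.ofMul (Units.mk0 _ hb') := by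
    rw [← ofMul_div]
    refine Additive.toMul.injective (Units.ext ?_)
    rw [hf, toMul_ofMul, Units.val_div_eq_div_val]
    rfl
  rw [h, map_sub, map_sub, divisorDegree_divisor_aux ha _ rfl, divisorDegree_divisor_aux hb _ rfl,
    sub_zero]

/-- The degree of a nonzero rational function: the number of its zeros, counted with
multiplicity. -/
noncomputable def functionDegree (f : W.FunctionFieldˣ) : ℕ :=
  (divisor (Additive.ofMul f)).sum fun _ n => n.toNat

end Points

section Antisymmetric

variable (G : Type*) [AddCommGroup G]

/-- The quotient `ℤ[G]⁻` of the free abelian group `ℤ[G]` by the subgroup generated by all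
`[ξ] + [-ξ]`. -/
def MinusGroup : Type _ :=
  (G →₀ ℤ) ⧸ AddSubgroup.closure
    (Set.range fun ξ : G => Finsupp.single ξ (1 : ℤ) + Finsupp.single (-ξ) 1)

noncomputable instance : AddCommGroup (MinusGroup G) :=
  inferInstanceAs (AddCommGroup ((G →₀ ℤ) ⧸ AddSubgroup.closure
    (Set.range fun ξ : G => Finsupp.single ξ (1 : ℤ) + Finsupp.single (-ξ) 1)))

variable {G}

/-- The class `[ξ]` in `ℤ[G]⁻`. -/
noncomputable def minusClass (ξ : G) : MinusGroup G :=
  QuotientAddGroup.mk' (AddSubgroup.closure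
    (Set.range fun ξ : G => Finsupp.single ξ (1 : ℤ) + Finsupp.single (-ξ) 1)) (Finsupp.single ξ 1)

lemma minusClass_neg (ξ : G) : minusClass (-ξ) = -minusClass ξ := by
  rw [eq_neg_iff_add_eq_zero, add_comm, minusClass, minusClass]
  refine (map_add _ _ _).symm.trans ((QuotientAddGroup.eq_zero_iff _).mpr ?_)
  exact AddSubgroup.subset_closure ⟨ξ, rfl⟩

/-- For `D = ∑ nᵢ [xᵢ]` and `D' = ∑ mⱼ [yⱼ]`, the element `∑ nᵢ mⱼ [xᵢ - yⱼ]` of `ℤ[G]⁻`. -/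
noncomputable def diffPairing (D D' : G →₀ ℤ) : MinusGroup G :=
  D.sum fun x n => D'.sum fun y m => (n * m) • minusClass (x - y)

lemma diffPairing_add_left (D₁ D₂ D' : G →₀ ℤ) :
    diffPairing (D₁ + D₂) D' = diffPairing D₁ D' + diffPairing D₂ D' := by
  classical
  refine Finsupp.sum_add_index' (fun x => by simp) fun x n n' => ?_
  rw [← Finsupp.sum_add]
  simp only [add_mul, add_smul]

lemma diffPairing_neg_swap (D D' : G →₀ ℤ) : diffPairing D' D = -diffPairing D D' := by
  rw [diffPairing, Finsupp.sum_comm, diffPairing, Finsupp.sum, Finsupp.sum,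
    ← Finset.sum_neg_distrib]
  refine Finset.sum_congr rfl fun x _ => ?_
  rw [Finsupp.sum, Finsupp.sum, ← Finset.sum_neg_distrib]
  refine Finset.sum_congr rfl fun y _ => ?_
  rw [← neg_sub x y, minusClass_neg, smul_neg, mul_comm]

lemma diffPairing_add_right (D D₁ D₂ : G →₀ ℤ) :
    diffPairing D (D₁ + D₂) = diffPairing D D₁ + diffPairing D D₂ := by
  rw [diffPairing_neg_swap, diffPairing_add_left, neg_add, ← diffPairing_neg_swap,
    ← diffPairing_neg_swap]

lemma diffPairing_zsmul_left (c : ℤ) (D D' : G →₀ ℤ) :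
    diffPairing (c • D) D' = c • diffPairing D D' :=
  map_zsmul (AddMonoidHom.mk' (diffPairing · D') fun D₁ D₂ => diffPairing_add_left D₁ D₂ D') c D

lemma diffPairing_zsmul_right (c : ℤ) (D D' : G →₀ ℤ) :
    diffPairing D (c • D') = c • diffPairing D D' :=
  map_zsmul (AddMonoidHom.mk' (diffPairing D) (diffPairing_add_right D)) c D'

lemma diffPairing_self (D : G →₀ ℤ) :
    diffPairing D D = divisorDegree D • minusClass (0 : G) := by
  have h0 : minusClass (0 : G) + minusClass 0 = 0 := by
    nth_rewrite 1 [← neg_zero]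
    rw [minusClass_neg, neg_add_cancel]
  induction D using Finsupp.induction_linear with
  | zero => simp [diffPairing]
  | add D D' h h' =>
    rw [diffPairing_add_left, diffPairing_add_right, diffPairing_add_right,
      diffPairing_neg_swap D D', h, h', map_add, add_smul]
    abel
  | single x n =>
    simp only [diffPairing, zero_mul, mul_zero, zero_smul, Finsupp.sum_single_index, sub_self,
      divisorDegree, Finsupp.liftAddHom_apply_single, AddMonoidHom.id_apply]
    obtain ⟨k, hk⟩ := Int.even_mul_pred_self n
    rw [← sub_eq_zero, ← sub_smul, show n * n - n = k + k by rw [← hk]; ring, add_smul,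
      ← smul_add, h0, smul_zero]

end Antisymmetric

section Bloch

variable [IsAlgClosed F] [W.IsElliptic] [DecidableEq F]

/-- The alternating form `(f, g) ↦ ∑ nᵢ mⱼ [xᵢ - yⱼ]`, where `∑ nᵢ [xᵢ]` and `∑ mⱼ [yⱼ]` are the
divisors of `f` and `g`. -/
noncomputable def betaAlternating :
    (Additive W.FunctionFieldˣ) [⋀^Fin 2]→ₗ[ℤ] MinusGroup W.Point where
  toFun v := diffPairing (divisor (v 0)) (divisor (v 1))
  map_update_add' v i f g := by
    fin_cases i <;> simp [diffPairing_add_left, diffPairing_add_right]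
  map_update_smul' v i c f := by
    fin_cases i <;> simp [diffPairing_zsmul_left, diffPairing_zsmul_right]
  map_eq_zero_of_eq' v i j hv hij := by
    have h : v 0 = v 1 := by
      fin_cases i <;> fin_cases j <;> simp_all
    rw [h, diffPairing_self, divisorDegree_divisor, zero_smul]

/-- The homomorphism `β` with `β (f ∧ g) = ∑ nᵢ mⱼ [xᵢ - yⱼ]`, as a map
`β : Λ² K^× → ℤ[E]⁻`. -/
noncomputable def beta :
    ⋀[ℤ]^2 (Additive W.FunctionFieldˣ) →ₗ[ℤ] MinusGroup W.Point :=
  exteriorPower.alternatingMapLinearEquiv betaAlternating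

/-- The element `f ∧ g` of `Λ² K^×`. -/
noncomputable def wedge (f g : W.FunctionFieldˣ) : ⋀[ℤ]^2 (Additive W.FunctionFieldˣ) :=
  exteriorPower.ιMulti ℤ 2 ![Additive.ofMul f, Additive.ofMul g]

lemma beta_wedge (f g : W.FunctionFieldˣ) : beta (wedge f g) =
    diffPairing (divisor (Additive.ofMul f)) (divisor (Additive.ofMul g)) :=
  exteriorPower.alternatingMapLinearEquiv_apply_ιMulti _ _

/-- The element `β (f ∧ (1 - f))` of `ℤ[E]⁻`, for `f ∈ K \ {0, 1}`. -/
noncomputable def blochRelation (f : W.FunctionField) (h0 : f ≠ 0) (h1 : f ≠ 1) :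
    MinusGroup W.Point :=
  beta (wedge (Units.mk0 f h0) (Units.mk0 (1 - f) (sub_ne_zero.mpr h1.symm)))

variable (W) in
/-- The group of elliptic Bloch relations: the subgroup of `ℤ[E]⁻` generated by all
`β (f ∧ (1 - f))`. -/
noncomputable def blochGroup : AddSubgroup (MinusGroup W.Point) :=
  AddSubgroup.closure {z | ∃ (f : W.FunctionField) (h0 : f ≠ 0) (h1 : f ≠ 1),
    z = blochRelation f h0 h1}

end Bloch
end EllipticBloch

namespace EllipticBloch

open Polynomial nonZeroDivisors
open WeierstrassCurve.Affine

/-! ### Orders of vanishing as valuations with residue field `F` -/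

section LocalOrders

variable {F : Type*} [Field F] {W : WeierstrassCurve.Affine F}

/-! The proof is a descent on `deg f` by the five-term relation. Let `u + v = 1` with `deg u = n ≥
4`. The zeros of `u`, the zeros of `v` and the common poles of `u` and `v` are three disjoint
effective divisors of degree `n`. Choose two points, possibly equal, in each: `p₀ + q₀`, `p₁ + q₁`
and `p + q`.

The geometric input is `exists_pencil`: one free point in each of three divisors of degree 3 is
enough freedom to find `y + y' = 1` with `div y = p₀ + q₀ + t - (p + q + r)` and `div y' = p₁ + q₁ +
t' - (p + q + r)`. Thus `y` imitates `u` at the six chosen points and has degree at most 3.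

The five-term relation for `u` and `y` expresses `β(u ∧ v)` through `β(y ∧ y')` and the relations of
`y/u`, `vy/(uy')` and `v/y'`. In each of these quotients two chosen zeros and two chosen poles
cancel, while only one new zero and one new pole appear, so the degree is at most `n - 2 + 1 = n -
1`, and induction applies.

The pencil is built from two facts: a function with divisor `P + Q - R - S` exists as soon as `P + Q
= R + S` in the group (`exists_divisor_eq`), and two functions of equal order at a point have a
linear combination of larger order there (`exists_lt_divisorOf_sub`). Remaining zeros are then
located by the fact that principal divisors have degree zero. -/

lemma poleOrder_smul_basis_le_iff (p q : F[X]) (n : ℕ) :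
    poleOrder (p • (1 : W.CoordinateRing) + q • CoordinateRing.mk W X) ≤ n ↔
      (p ≠ 0 → 2 * p.natDegree ≤ n) ∧ (q ≠ 0 → 2 * q.natDegree + 3 ≤ n) := by
  rw [poleOrder, natDegree_le_iff_degree_le, CoordinateRing.degree_norm_smul_basis, max_le_iff]
  refine and_congr ?_ ?_
  · by_cases hp : p = 0
    · simp [hp]
    · simp only [degree_eq_natDegree hp, ne_eq, hp, not_false_eq_true, forall_const, nsmul_eq_mul]
      norm_cast
  · by_cases hq : q = 0
    · simp [hq]
    · simp only [degree_eq_natDegree hq, ne_eq, hq, not_false_eq_true, forall_const, nsmul_eq_mul]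
      norm_cast

lemma smul_basis_eq_zero_or_poleOrder_lt {p q : F[X]} {n : ℕ}
    (hp : p ≠ 0 → 2 * p.natDegree < n) (hq : q ≠ 0 → 2 * q.natDegree + 3 < n) :
    p • (1 : W.CoordinateRing) + q • CoordinateRing.mk W X = 0 ∨
      poleOrder (p • (1 : W.CoordinateRing) + q • CoordinateRing.mk W X) < n := by
  by_cases h : p = 0 ∧ q = 0
  · left
    simp [h.1, h.2]
  · right
    have hn : 0 < n := by
      by_cases hp0 : p = 0
      · exact (Nat.zero_le _).trans_lt (hq fun hq0 => h ⟨hp0, hq0⟩)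
      · exact (Nat.zero_le _).trans_lt (hp hp0)
    have := (poleOrder_smul_basis_le_iff (W := W) p q (n - 1)).mpr
      ⟨fun h => by have := hp h; omega, fun h => by have := hq h; omega⟩
    omega

lemma poleOrder_add_le (a b : W.CoordinateRing) :
    poleOrder (a + b) ≤ max (poleOrder a) (poleOrder b) := by
  obtain ⟨p, q, rfl⟩ := CoordinateRing.exists_smul_basis_eq a
  obtain ⟨p', q', rfl⟩ := CoordinateRing.exists_smul_basis_eq b
  obtain ⟨h1, h2⟩ := (poleOrder_smul_basis_le_iff (W := W) p q _).mp le_rfl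
  obtain ⟨h3, h4⟩ := (poleOrder_smul_basis_le_iff (W := W) p' q' _).mp le_rfl
  generalize poleOrder (p • (1 : W.CoordinateRing) + q • CoordinateRing.mk W X) = m at *
  generalize poleOrder (p' • (1 : W.CoordinateRing) + q' • CoordinateRing.mk W X) = n at *
  rw [add_add_add_comm, ← add_smul, ← add_smul, poleOrder_smul_basis_le_iff]
  have key : ∀ {r s : F[X]} {e : ℕ}, (r ≠ 0 → 2 * r.natDegree + e ≤ m) →
      (s ≠ 0 → 2 * s.natDegree + e ≤ n) → r + s ≠ 0 → 2 * (r + s).natDegree + e ≤ max m n := by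
    intro r s e hr hs h
    by_cases hr0 : r = 0
    · subst hr0
      rw [zero_add] at h ⊢
      exact (hs h).trans (le_max_right _ _)
    by_cases hs0 : s = 0
    · subst hs0
      rw [add_zero]
      exact (hr hr0).trans (le_max_left _ _)
    have := natDegree_add_le r s
    have := hr hr0
    have := hs hs0
    omega
  exact ⟨key (e := 0) h1 h3, key h2 h4⟩

lemma poleOrder_algebraMap (c : F) : poleOrder (algebraMap F W.CoordinateRing c) = 0 := by
  have : algebraMap F W.CoordinateRing c = C c • (1 : W.CoordinateRing) +
      (0 : F[X]) • CoordinateRing.mk W X := by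
    rw [zero_smul, add_zero, Algebra.smul_def, mul_one]
    rfl
  rw [this, ← Nat.le_zero, poleOrder_smul_basis_le_iff]
  simp

/-- The quotient of leading coefficients serves as `c`. The orders `2 deg p` and `2 deg q + 3` have
opposite parity, so equal pole orders force the same basis component to dominate in both functions.
-/
lemma exists_poleOrder_sub_lt {a b : W.CoordinateRing} (ha : a ≠ 0) (hb : b ≠ 0)
    (h : poleOrder a = poleOrder b) :
    ∃ c : F, a - algebraMap F _ c * b = 0 ∨ poleOrder (a - algebraMap F _ c * b) < poleOrder b := by
  obtain ⟨p, q, rfl⟩ := CoordinateRing.exists_smul_basis_eq a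
  obtain ⟨p', q', rfl⟩ := CoordinateRing.exists_smul_basis_eq b
  obtain ⟨h1, h2⟩ := (poleOrder_smul_basis_le_iff (W := W) p q _).mp le_rfl
  obtain ⟨h3, h4⟩ := (poleOrder_smul_basis_le_iff (W := W) p' q' _).mp le_rfl
  have hlead : ∀ {p q : F[X]} {n : ℕ}, p • (1 : W.CoordinateRing) + q • CoordinateRing.mk W X ≠ 0 →
      poleOrder (p • (1 : W.CoordinateRing) + q • CoordinateRing.mk W X) = n →
      (p ≠ 0 → 2 * p.natDegree ≤ n) → (q ≠ 0 → 2 * q.natDegree + 3 ≤ n) →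
      (p ≠ 0 ∧ 2 * p.natDegree = n) ∨ (q ≠ 0 ∧ 2 * q.natDegree + 3 = n) := by
    intro p q n h0 hn hp hq
    by_contra! hcon
    have := smul_basis_eq_zero_or_poleOrder_lt (W := W) (p := p) (q := q) (n := n)
      (fun h => lt_of_le_of_ne (hp h) (hcon.1 h)) (fun h => lt_of_le_of_ne (hq h) (hcon.2 h))
    exact this.elim h0 (by omega)
  have hl' := hlead hb rfl h3 h4
  rw [h] at h1 h2
  have hl := hlead ha h h1 h2
  generalize poleOrder (p' • (1 : W.CoordinateRing) + q' • CoordinateRing.mk W X) = n at *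
  have hsub : ∀ c : F, p • (1 : W.CoordinateRing) + q • CoordinateRing.mk W X -
      algebraMap F _ c * (p' • 1 + q' • CoordinateRing.mk W X) =
        (p - C c * p') • (1 : W.CoordinateRing) + (q - C c * q') • CoordinateRing.mk W X := by
    intro c
    have : algebraMap F W.CoordinateRing c = algebraMap F[X] W.CoordinateRing (C c) := rfl
    rw [this, ← Algebra.smul_def]
    module
  have heq : ∀ {r s : F[X]}, r ≠ 0 → s ≠ 0 → r.natDegree = s.natDegree →
      r - C (r.leadingCoeff / s.leadingCoeff) * s ≠ 0 →
      (r - C (r.leadingCoeff / s.leadingCoeff) * s).natDegree < r.natDegree := by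
    intro r s hr hs hrs h0
    have hc : r.leadingCoeff / s.leadingCoeff ≠ 0 := by simp [hr, hs]
    refine natDegree_lt_natDegree h0 (degree_sub_lt_left ?_ hr ?_)
    · rw [degree_C_mul hc, degree_eq_natDegree hr, degree_eq_natDegree hs, hrs]
    · rw [leadingCoeff_mul, leadingCoeff_C, div_mul_cancel₀]
      simpa
  -- The component of the wrong parity cannot attain the bound `n`, so its inequality is strict for
  -- any choice of `c`.
  have hne : ∀ {r s : F[X]} {e : ℕ} (c : F), (r ≠ 0 → 2 * r.natDegree + e ≤ n) →
      (s ≠ 0 → 2 * s.natDegree + e ≤ n) → (n + e) % 2 = 1 → r - C c * s ≠ 0 →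
      2 * (r - C c * s).natDegree + e < n := by
    intro r s e c hr hs hpar h0
    have hle := (natDegree_sub_le r (C c * s)).trans (max_le_max le_rfl (natDegree_C_mul_le c s))
    by_cases hr0 : r = 0
    · by_cases hs0 : s = 0
      · simp [hr0, hs0] at h0
      have := hs hs0
      rw [hr0, natDegree_zero, Nat.max_eq_right (Nat.zero_le _), ← hr0] at hle
      omega
    · by_cases hs0 : s = 0
      · have := hr hr0
        rw [hs0, natDegree_zero, Nat.max_eq_left (Nat.zero_le _), ← hs0] at hle
        omega
      have := hr hr0
      have := hs hs0
      omega
  rcases hl with ⟨hp, hpn⟩ | ⟨hq, hqn⟩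
  · obtain ⟨hp', hpn'⟩ := hl'.resolve_right fun h => by omega
    refine ⟨p.leadingCoeff / p'.leadingCoeff, ?_⟩
    rw [hsub]
    refine smul_basis_eq_zero_or_poleOrder_lt (fun h0 => ?_) (hne _ h2 h4 (by omega))
    have := heq hp hp' (by omega) h0
    omega
  · obtain ⟨hq', hqn'⟩ := hl'.resolve_left fun h => by omega
    refine ⟨q.leadingCoeff / q'.leadingCoeff, ?_⟩
    rw [hsub]
    refine smul_basis_eq_zero_or_poleOrder_lt (hne (e := 0) _ h1 h3 (by omega)) (fun h0 => ?_)
    have := heq hq hq' (by omega) h0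
    omega

lemma le_count_span_iff {R K : Type*} [CommRing R] [IsDedekindDomain R] [Field K] [Algebra R K]
    [IsFractionRing R K] (v : IsDedekindDomain.HeightOneSpectrum R) {a : R} (ha : a ≠ 0) (n : ℕ) :
    (n : ℤ) ≤ FractionalIdeal.count K v (FractionalIdeal.spanSingleton R⁰ (algebraMap R K a)) ↔
      a ∈ v.asIdeal ^ n := by
  classical
  rw [← FractionalIdeal.coeIdeal_span_singleton, FractionalIdeal.count_coe, Nat.cast_le,
    ← v.intValuation_le_pow_iff_mem, v.intValuation_if_neg ha, WithZero.exp_le_exp,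
    neg_le_neg_iff, Nat.cast_le]
  rwa [Ne, Ideal.zero_eq_bot, Ideal.span_singleton_eq_bot]

lemma exists_sub_mem_xyIdeal {x y : F} (h : W.Equation x y) (a : W.CoordinateRing) :
    ∃ c : F, a - algebraMap F _ c ∈ CoordinateRing.XYIdeal W x (C y) := by
  let e := CoordinateRing.quotientXYIdealEquiv (W' := W) (x := x) (y := C y) h
  refine ⟨e (Ideal.Quotient.mk _ a), Ideal.Quotient.eq.mp (e.injective ?_)⟩
  exact (e.commutes _).symm

lemma exists_eq_div_div {f g : W.FunctionField} (hf : f ≠ 0) (hg : g ≠ 0) :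
    ∃ a b s : W.CoordinateRing, a ≠ 0 ∧ b ≠ 0 ∧ s ≠ 0 ∧
      f = algebraMap _ W.FunctionField a / algebraMap _ W.FunctionField s ∧
      g = algebraMap _ W.FunctionField b / algebraMap _ W.FunctionField s := by
  have hinj := IsFractionRing.injective W.CoordinateRing W.FunctionField
  obtain ⟨a, b, ha, hb, rfl⟩ := exists_eq_div hf
  obtain ⟨c, d, hc, hd, rfl⟩ := exists_eq_div hg
  have hb' : algebraMap _ W.FunctionField b ≠ 0 := (map_ne_zero_iff _ hinj).mpr hb
  have hd' : algebraMap _ W.FunctionField d ≠ 0 := (map_ne_zero_iff _ hinj).mpr hd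
  refine ⟨a * d, c * b, b * d, mul_ne_zero ha hd, mul_ne_zero hc hb, mul_ne_zero hb hd, ?_, ?_⟩
  · simp only [map_mul]
    field_simp
  · simp only [map_mul]
    field_simp

variable [IsAlgClosed F] [W.IsElliptic]

lemma ord_zero_algebraMap {a : W.CoordinateRing} (ha : a ≠ 0) :
    ord (.zero : W.Point) (algebraMap _ W.FunctionField a) = -poleOrder a := by
  have h := ordInfinity_div ha one_ne_zero
  have h1 : poleOrder (1 : W.CoordinateRing) = 0 := by
    rw [← map_one (algebraMap F W.CoordinateRing), poleOrder_algebraMap]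
  rwa [map_one, div_one, h1, Nat.cast_zero, zero_sub] at h

lemma le_ord_some_algebraMap_iff {x y : F} (h : W.Nonsingular x y) {a : W.CoordinateRing}
    (ha : a ≠ 0) (n : ℕ) : (n : ℤ) ≤ ord (.some x y h) (algebraMap _ W.FunctionField a) ↔
      a ∈ CoordinateRing.XYIdeal W x (C y) ^ n :=
  le_count_span_iff (pointPrime h) ha n

lemma ord_some_algebraMap_nonneg {x y : F} (h : W.Nonsingular x y) {a : W.CoordinateRing}
    (ha : a ≠ 0) : 0 ≤ ord (.some x y h) (algebraMap _ W.FunctionField a) := by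
  simpa using le_ord_some_algebraMap_iff h ha 0

lemma le_ord_algebraMap_add (P : W.Point) {a b : W.CoordinateRing} (ha : a ≠ 0) (hb : b ≠ 0)
    (hab : a + b ≠ 0) :
    min (ord P (algebraMap _ W.FunctionField a)) (ord P (algebraMap _ W.FunctionField b)) ≤
      ord P (algebraMap _ W.FunctionField (a + b)) := by
  rcases P with _ | ⟨x, y, h⟩
  · rw [ord_zero_algebraMap ha, ord_zero_algebraMap hb, ord_zero_algebraMap hab]
    have := poleOrder_add_le a b
    omega
  · have ha' := le_ord_some_algebraMap_iff h ha
    have hb' := le_ord_some_algebraMap_iff h hb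
    obtain ⟨n, hn⟩ := Int.eq_ofNat_of_zero_le (le_min (ord_some_algebraMap_nonneg h ha)
      (ord_some_algebraMap_nonneg h hb))
    rw [hn, le_ord_some_algebraMap_iff h hab]
    exact add_mem ((ha' n).mp (hn ▸ min_le_left _ _)) ((hb' n).mp (hn ▸ min_le_right _ _))

lemma exists_ord_algebraMap_sub_lt (P : W.Point) {a b : W.CoordinateRing} (ha : a ≠ 0) (hb : b ≠ 0)
    (hab : ord P (algebraMap _ W.FunctionField a) = ord P (algebraMap _ W.FunctionField b)) :
    ∃ c : F, a - algebraMap F _ c * b = 0 ∨ ord P (algebraMap _ W.FunctionField b) <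
      ord P (algebraMap _ W.FunctionField (a - algebraMap F _ c * b)) := by
  rcases P with _ | ⟨x, y, h⟩
  · rw [ord_zero_algebraMap ha, ord_zero_algebraMap hb] at hab
    obtain ⟨c, hc⟩ := exists_poleOrder_sub_lt ha hb (by omega)
    refine ⟨c, or_iff_not_imp_left.mpr fun h0 => ?_⟩
    rw [ord_zero_algebraMap hb, ord_zero_algebraMap h0]
    have := hc.resolve_left h0
    omega
  · obtain ⟨n, hn⟩ := Int.eq_ofNat_of_zero_le (ord_some_algebraMap_nonneg h hb)
    have := (xyIdeal_isMaximal h.1).isPrime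
    -- In a Dedekind domain `P ^ n / P ^ (n + 1)` is a line over the residue field, spanned by the
    -- class of `b`. The residue field is `F`, so the coefficient `d` may be replaced by a constant.
    obtain ⟨d, e, he, hde⟩ := Ideal.exists_mul_add_mem_pow_succ (i := n)
      (xyIdeal_ne_bot (W := W) x y) b a ((le_ord_some_algebraMap_iff h hb n).mp hn.ge)
      (fun hb' => by
        have := (le_ord_some_algebraMap_iff h hb _).mpr hb'
        push_cast at this
        omega)
      ((le_ord_some_algebraMap_iff h ha n).mp (hab.trans hn).ge)
    obtain ⟨c, hc⟩ := exists_sub_mem_xyIdeal h.1 d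
    refine ⟨c, or_iff_not_imp_left.mpr fun h0 => ?_⟩
    rw [hn, ← Int.add_one_le_iff]
    refine (le_ord_some_algebraMap_iff h h0 (n + 1)).mpr ?_
    have : a - algebraMap F _ c * b = b * (d - algebraMap F _ c) + e := by
      rw [← hde]
      ring
    rw [this]
    refine add_mem ?_ he
    rw [pow_succ]
    exact Ideal.mul_mem_mul ((le_ord_some_algebraMap_iff h hb n).mp hn.ge) hc

lemma ord_div (P : W.Point) {f g : W.FunctionField} (hf : f ≠ 0) (hg : g ≠ 0) :
    ord P (f / g) = ord P f - ord P g := by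
  have := ord_mul P (div_ne_zero hf hg) hg
  rw [div_mul_cancel₀ _ hg] at this
  omega

lemma le_ord_add (P : W.Point) {f g : W.FunctionField} (hf : f ≠ 0) (hg : g ≠ 0)
    (hfg : f + g ≠ 0) : min (ord P f) (ord P g) ≤ ord P (f + g) := by
  have hinj := IsFractionRing.injective W.CoordinateRing W.FunctionField
  obtain ⟨a, b, s, ha, hb, hs, rfl, rfl⟩ := exists_eq_div_div hf hg
  have hs' : algebraMap _ W.FunctionField s ≠ 0 := (map_ne_zero_iff _ hinj).mpr hs
  rw [← add_div, ← map_add] at hfg ⊢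
  have hab : a + b ≠ 0 := by
    rintro h
    simp [h] at hfg
  rw [ord_div P ((map_ne_zero_iff _ hinj).mpr ha) hs',
    ord_div P ((map_ne_zero_iff _ hinj).mpr hb) hs',
    ord_div P ((map_ne_zero_iff _ hinj).mpr hab) hs', min_sub_sub_right]
  exact sub_le_sub_right (le_ord_algebraMap_add P ha hb hab) _

lemma exists_ord_sub_lt (P : W.Point) {f g : W.FunctionField} (hf : f ≠ 0) (hg : g ≠ 0)
    (hfg : ord P f = ord P g) : ∃ c : F, f - algebraMap F _ c * g = 0 ∨
      ord P g < ord P (f - algebraMap F _ c * g) := by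
  have hinj := IsFractionRing.injective W.CoordinateRing W.FunctionField
  obtain ⟨a, b, s, ha, hb, hs, rfl, rfl⟩ := exists_eq_div_div hf hg
  have hs' : algebraMap _ W.FunctionField s ≠ 0 := (map_ne_zero_iff _ hinj).mpr hs
  have ha' := (map_ne_zero_iff _ hinj).mpr ha
  have hb' := (map_ne_zero_iff _ hinj).mpr hb
  rw [ord_div P ha' hs', ord_div P hb' hs', sub_left_inj] at hfg
  obtain ⟨c, hc⟩ := exists_ord_algebraMap_sub_lt P ha hb hfg
  have hsub : algebraMap _ W.FunctionField a / algebraMap _ W.FunctionField s -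
      algebraMap F _ c * (algebraMap _ W.FunctionField b / algebraMap _ W.FunctionField s) =
        algebraMap _ W.FunctionField (a - algebraMap F _ c * b) /
          algebraMap _ W.FunctionField s := by
    rw [map_sub, map_mul, ← IsScalarTower.algebraMap_apply, sub_div, mul_div_assoc]
  refine ⟨c, or_iff_not_imp_left.mpr fun h0 => ?_⟩
  rw [hsub] at h0 ⊢
  have h0' : a - algebraMap F _ c * b ≠ 0 := fun h => h0 (by rw [h, map_zero, zero_div])
  rw [ord_div P hb' hs', ord_div P ((map_ne_zero_iff _ hinj).mpr h0') hs']
  exact sub_lt_sub_right (hc.resolve_left h0') _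

/-- Constants are regular at every point, so `c` and `c⁻¹` both have nonnegative order, and these
orders add up to zero. -/
lemma ord_algebraMap (P : W.Point) {c : F} (hc : c ≠ 0) :
    ord P (algebraMap F W.FunctionField c) = 0 := by
  have hinj := (algebraMap F W.CoordinateRing).injective
  have key : ∀ d : F, d ≠ 0 → 0 ≤ ord P (algebraMap F W.FunctionField d) := by
    intro d hd
    rw [IsScalarTower.algebraMap_apply F W.CoordinateRing]
    have hd' := (map_ne_zero_iff _ hinj).mpr hd
    rcases P with _ | ⟨x, y, h⟩
    · rw [ord_zero_algebraMap hd', poleOrder_algebraMap, Nat.cast_zero, neg_zero]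
    · exact ord_some_algebraMap_nonneg h hd'
  have h1 := ord_mul P (f := algebraMap F W.FunctionField c) (g := algebraMap F W.FunctionField c⁻¹)
    (by simpa) (by simpa)
  have h2 := ord_mul P (one_ne_zero (α := W.FunctionField)) one_ne_zero
  rw [← map_mul, mul_inv_cancel₀ hc, map_one] at h1
  rw [mul_one] at h2
  have := key c hc
  have := key c⁻¹ (inv_ne_zero hc)
  omega

end LocalOrders

/-! ### Functions with divisor `P + Q - R - S` -/

lemma divisorDegree_single {X : Type*} (x : X) (n : ℤ) :
    divisorDegree (Finsupp.single x n) = n := by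
  simp only [divisorDegree, Finsupp.liftAddHom_apply_single, AddMonoidHom.id_apply]

lemma eq_zero_of_divisorDegree_eq_zero {X : Type*} {D : X →₀ ℤ} (x : X) (hD : divisorDegree D = 0)
    (h : ∀ y ≠ x, D y = 0) : D = 0 := by
  classical
  have hs : D = Finsupp.single x (D x) := by
    ext y
    by_cases hy : y = x
    · subst hy
      simp
    · rw [h y hy, Finsupp.single_apply, if_neg (Ne.symm hy)]
  rw [hs] at hD
  rw [divisorDegree_single] at hD
  rw [hs, hD, Finsupp.single_zero]

section Abel

variable {F : Type*} [Field F] {W : WeierstrassCurve.Affine F}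

/-- The invertible fractional ideal of the affine coordinate ring of an affine point, and the unit
ideal for the point at infinity. -/
noncomputable def pointIdeal : W.Point → (FractionalIdeal W.CoordinateRing⁰ W.FunctionField)ˣ
  | .zero => 1
  | .some _ _ h => CoordinateRing.XYIdeal' h

lemma toClass_eq_mk_pointIdeal [DecidableEq F] (P : W.Point) : Point.toClass P =
    Additive.ofMul (ClassGroup.mk W.FunctionField (pointIdeal P)) := by
  rcases P with _ | ⟨x, y, h⟩
  · simp only [pointIdeal, map_one]
    rfl
  · rfl

variable [IsAlgClosed F] [W.IsElliptic]

lemma affineDivisor_pointIdeal_apply (P : W.Point) {X : W.Point} (hX : X ≠ .zero) :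
    affineDivisor (pointIdeal P : FractionalIdeal W.CoordinateRing⁰ W.FunctionField) X =
      Finsupp.single P 1 X := by
  classical
  rcases P with _ | ⟨x, y, h⟩
  · have h1 := affineDivisor_mul (W := W) one_ne_zero one_ne_zero
    rw [mul_one, left_eq_add] at h1
    rw [pointIdeal, Units.val_one, h1, Finsupp.single_apply, if_neg hX.symm, Finsupp.zero_apply]
  · rw [pointIdeal, CoordinateRing.XYIdeal'_eq, affineDivisor_point]

lemma divisor_apply_eq_affineDivisor (f : W.FunctionFieldˣ) {X : W.Point} (hX : X ≠ .zero) :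
    divisor (Additive.ofMul f) X = affineDivisor
      (FractionalIdeal.spanSingleton W.CoordinateRing⁰ (f : W.FunctionField)) X := by
  rcases X with _ | ⟨x, y, h⟩
  · exact absurd rfl hX
  · rfl

/-- The homomorphism `Point.toClass` turns the group relation into an equality of ideal classes,
whose principal factor is generated by `f`. -/
lemma exists_divisor_eq [DecidableEq F] {P Q R S : W.Point} (h : P + Q = R + S) :
    ∃ f : W.FunctionFieldˣ, divisor (Additive.ofMul f) = Finsupp.single P 1 + Finsupp.single Q 1 -
      (Finsupp.single R 1 + Finsupp.single S 1) := by
  have hcl := congr_arg Point.toClass h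
  simp only [map_add, toClass_eq_mk_pointIdeal, ← ofMul_mul, ← map_mul] at hcl
  obtain ⟨f, hf⟩ := ClassGroup.mk_eq_mk.mp (Additive.ofMul.injective hcl).symm
  -- The ideals determine the divisor at affine points only; the coefficient at infinity is then
  -- forced because both sides have degree zero.
  refine ⟨f, sub_eq_zero.mp (eq_zero_of_divisorDegree_eq_zero .zero ?_ fun X hX => ?_)⟩
  · rw [map_sub, divisorDegree_divisor]
    simp only [map_sub, map_add, divisorDegree_single]
    norm_num
  · have := congr_arg (fun I : (FractionalIdeal W.CoordinateRing⁰ W.FunctionField)ˣ =>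
      affineDivisor (I : FractionalIdeal W.CoordinateRing⁰ W.FunctionField) X) hf
    simp only [Units.val_mul, coe_toPrincipalIdeal] at this
    rw [affineDivisor_mul (by simp) (FractionalIdeal.spanSingleton_ne_zero_iff.mpr f.ne_zero),
      affineDivisor_mul (by simp) (by simp), affineDivisor_mul (by simp) (by simp)] at this
    simp only [Finsupp.add_apply, affineDivisor_pointIdeal_apply _ hX,
      ← divisor_apply_eq_affineDivisor f hX] at this
    simp only [Finsupp.sub_apply, Finsupp.add_apply]
    linarith

end Abel

/-! ### Effective divisors of small degree -/

section EffectiveDivisors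

variable {X : Type*}

lemma divisorDegree_nonneg {D : X →₀ ℤ} (hD : 0 ≤ D) : 0 ≤ divisorDegree D := by
  simp only [divisorDegree, Finsupp.liftAddHom_apply]
  exact Finset.sum_nonneg fun x _ => hD x

lemma divisorDegree_mono {D D' : X →₀ ℤ} (h : D ≤ D') : divisorDegree D ≤ divisorDegree D' := by
  have := divisorDegree_nonneg (sub_nonneg.mpr h)
  rw [map_sub] at this
  omega

lemma exists_single_le {D : X →₀ ℤ} (hD : 0 ≤ D) (h : 0 < divisorDegree D) :
    ∃ x, Finsupp.single x 1 ≤ D := by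
  classical
  obtain ⟨x, hx⟩ : ∃ x, D x ≠ 0 := by
    by_contra! h0
    rw [show D = 0 from Finsupp.ext h0, map_zero] at h
    exact h.false
  refine ⟨x, fun y => ?_⟩
  have := hD x
  have := hD y
  simp only [Finsupp.coe_zero, Pi.zero_apply] at *
  rw [Finsupp.single_apply]
  split_ifs with hxy
  · subst hxy
    omega
  · assumption

lemma eq_of_le_of_divisorDegree_eq {D D' : X →₀ ℤ} (h : D ≤ D')
    (hd : divisorDegree D = divisorDegree D') : D = D' := by
  by_contra hne
  obtain ⟨x, hx⟩ : ∃ x, (D' - D) x ≠ 0 := by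
    by_contra! h0
    exact hne (sub_eq_zero.mp (Finsupp.ext h0)).symm
  classical
  have h1 : Finsupp.single x 1 ≤ D' - D := fun y => by
    have := h y
    have := h x
    rw [Finsupp.sub_apply] at *
    rw [Finsupp.single_apply]
    split_ifs with hxy
    · subst hxy
      omega
    · omega
  have := divisorDegree_mono h1
  rw [divisorDegree_single, map_sub] at this
  omega

lemma exists_eq_add_single {D D' : X →₀ ℤ} (h : D ≤ D')
    (hd : divisorDegree D' = divisorDegree D + 1) : ∃ x, D' = D + Finsupp.single x 1 := by
  obtain ⟨x, hx⟩ := exists_single_le (sub_nonneg.mpr h) (by rw [map_sub]; omega)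
  refine ⟨x, (eq_of_le_of_divisorDegree_eq ?_ ?_).symm⟩
  · rwa [le_sub_iff_add_le'] at hx
  · rw [map_add, divisorDegree_single, hd]

lemma exists_eq_add_single_add_single {D D' : X →₀ ℤ} (h : D ≤ D')
    (hd : divisorDegree D' = divisorDegree D + 2) :
    ∃ x y, D' = D + Finsupp.single x 1 + Finsupp.single y 1 := by
  obtain ⟨x, hx⟩ := exists_single_le (sub_nonneg.mpr h) (by rw [map_sub]; omega)
  rw [le_sub_iff_add_le'] at hx
  obtain ⟨y, hy⟩ := exists_eq_add_single hx (by rw [map_add, divisorDegree_single, hd]; ring)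
  exact ⟨x, y, hy⟩

lemma exists_single_add_single_le {D : X →₀ ℤ} (hD : 0 ≤ D) (h : 2 ≤ divisorDegree D) :
    ∃ x y, Finsupp.single x 1 + Finsupp.single y 1 ≤ D := by
  obtain ⟨x, hx⟩ := exists_single_le hD (by omega)
  obtain ⟨y, hy⟩ := exists_single_le (sub_nonneg.mpr hx)
    (by rw [map_sub, divisorDegree_single]; omega)
  exact ⟨x, y, by rwa [le_sub_iff_add_le'] at hy⟩

lemma sum_toNat_eq_divisorDegree (D : X →₀ ℤ) :
    ((D.sum fun _ n => n.toNat : ℕ) : ℤ) = divisorDegree (D ⊔ 0) := by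
  classical
  simp only [divisorDegree, Finsupp.liftAddHom_apply, Finsupp.sum, Nat.cast_sum,
    AddMonoidHom.id_apply]
  rw [Finset.sum_subset (s₁ := (D ⊔ 0).support) (s₂ := D.support)]
  · simp
  · intro x hx
    simp only [Finsupp.mem_support_iff, Finsupp.sup_apply, Finsupp.coe_zero, Pi.zero_apply] at *
    omega
  · intro x _ hx
    simpa using hx

end EffectiveDivisors

/-! ### Divisors of linear combinations of functions -/

section Valuations

variable {F : Type*} [Field F] {W : WeierstrassCurve.Affine F} [IsAlgClosed F] [W.IsElliptic]

/-- The divisor of an invertible rational function. -/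
noncomputable abbrev divisorOf (f : W.FunctionFieldˣ) : W.Point →₀ ℤ :=
  divisor (Additive.ofMul f)

lemma divisorOf_apply (f : W.FunctionFieldˣ) (P : W.Point) :
    divisorOf f P = ord P (f : W.FunctionField) := rfl

lemma divisorOf_mul (f g : W.FunctionFieldˣ) : divisorOf (f * g) = divisorOf f + divisorOf g :=
  map_add divisor _ _

lemma divisorOf_div (f g : W.FunctionFieldˣ) : divisorOf (f / g) = divisorOf f - divisorOf g :=
  map_sub divisor _ _

lemma divisorOf_one : divisorOf (1 : W.FunctionFieldˣ) = 0 :=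
  map_zero divisor

lemma divisorDegree_divisorOf (f : W.FunctionFieldˣ) : divisorDegree (divisorOf f) = 0 :=
  divisorDegree_divisor _

lemma divisorOf_eq_of_eq_smul {f g : W.FunctionFieldˣ} {c : F}
    (h : (f : W.FunctionField) = c • (g : W.FunctionField)) : divisorOf f = divisorOf g := by
  have hc : c ≠ 0 := by
    rintro rfl
    exact f.ne_zero (by rw [h, zero_smul])
  ext P
  rw [divisorOf_apply, divisorOf_apply, h, Algebra.smul_def, ord_mul P (by simpa) g.ne_zero,
    ord_algebraMap P hc, zero_add]

lemma min_le_divisorOf {f g h : W.FunctionFieldˣ} {a b : F}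
    (hh : (h : W.FunctionField) = a • (f : W.FunctionField) + b • (g : W.FunctionField))
    (P : W.Point) : min (divisorOf f P) (divisorOf g P) ≤ divisorOf h P := by
  by_cases ha : a = 0
  · rw [ha, zero_smul, zero_add] at hh
    rw [divisorOf_eq_of_eq_smul hh]
    exact min_le_right _ _
  by_cases hb : b = 0
  · rw [hb, zero_smul, add_zero] at hh
    rw [divisorOf_eq_of_eq_smul hh]
    exact min_le_left _ _
  have hf0 : a • (f : W.FunctionField) ≠ 0 := smul_ne_zero ha f.ne_zero
  have hg0 : b • (g : W.FunctionField) ≠ 0 := smul_ne_zero hb g.ne_zero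
  rw [← divisorOf_eq_of_eq_smul (f := Units.mk0 _ hf0) (g := f) rfl,
    ← divisorOf_eq_of_eq_smul (f := Units.mk0 _ hg0) (g := g) rfl, divisorOf_apply, divisorOf_apply,
    divisorOf_apply, hh]
  exact le_ord_add P hf0 hg0 (hh ▸ h.ne_zero)

lemma exists_lt_divisorOf_sub {f g : W.FunctionFieldˣ} {P : W.Point}
    (h : divisorOf f P = divisorOf g P) : ∃ c : F, c ≠ 0 ∧ ∀ u : W.FunctionFieldˣ,
      (u : W.FunctionField) = f - c • (g : W.FunctionField) → divisorOf g P < divisorOf u P := by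
  obtain ⟨c, hc⟩ := exists_ord_sub_lt P f.ne_zero g.ne_zero h
  rw [← Algebra.smul_def] at hc
  refine ⟨c, ?_, fun u hu => ?_⟩
  · rintro rfl
    rw [zero_smul, sub_zero] at hc
    exact hc.elim f.ne_zero fun h' => h'.ne h.symm
  · rw [divisorOf_apply u, hu]
    exact hc.resolve_left (hu ▸ u.ne_zero)

lemma exists_divisorOf_sub_pos {f : W.FunctionFieldˣ} {P : W.Point} (h : 0 ≤ divisorOf f P) :
    ∃ c : F, ∀ u : W.FunctionFieldˣ,
      (u : W.FunctionField) = f - c • (1 : W.FunctionField) → 0 < divisorOf u P := by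
  -- If `f` is a unit at `P`, subtract its value there; if it already vanishes, subtract `0`.
  rcases h.eq_or_lt with h | h
  · obtain ⟨c, -, hc⟩ := exists_lt_divisorOf_sub (f := f) (g := 1) (P := P)
      (by rw [← h, divisorOf_one, Finsupp.zero_apply])
    refine ⟨c, fun u hu => ?_⟩
    have := hc u hu
    rwa [divisorOf_one, Finsupp.zero_apply] at this
  · refine ⟨0, fun u hu => ?_⟩
    rw [zero_smul, sub_zero] at hu
    rwa [Units.ext hu]

lemma exists_unit_eq_sub_smul {f g : W.FunctionFieldˣ} (h : divisorOf f ≠ divisorOf g) (c : F) :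
    ∃ u : W.FunctionFieldˣ, (u : W.FunctionField) = f - c • (g : W.FunctionField) :=
  ⟨Units.mk0 _ (sub_ne_zero.mpr fun h' => h (divisorOf_eq_of_eq_smul h')), rfl⟩

lemma functionDegree_eq (f : W.FunctionFieldˣ) :
    (functionDegree f : ℤ) = divisorDegree (divisorOf f ⊔ 0) :=
  sum_toNat_eq_divisorDegree _

/-- `A` and `B` may share points: cancellation only lowers the degree. Hence coincidences among the
auxiliary points of the pencil need no separate treatment. -/
lemma functionDegree_le {f : W.FunctionFieldˣ} {A B : W.Point →₀ ℤ} (hA : 0 ≤ A) (hB : 0 ≤ B)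
    (h : divisorOf f = A - B) : (functionDegree f : ℤ) ≤ divisorDegree A := by
  rw [functionDegree_eq, h]
  exact divisorDegree_mono (sup_le (sub_le_self _ hB) hA)

end Valuations

/-! ### Pencils of degree at most three through prescribed points -/

section Pencil

/-- The divisor `[x]`. -/
noncomputable abbrev pt {X : Type*} (x : X) : X →₀ ℤ := Finsupp.single x 1

lemma pt_self {X : Type*} (x : X) : pt x x = 1 := Finsupp.single_eq_same

lemma pt_of_ne {X : Type*} {x y : X} (h : y ≠ x) : pt x y = 0 := Finsupp.single_eq_of_ne h

lemma pt_nonneg {X : Type*} (x y : X) : 0 ≤ pt x y := by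
  by_cases h : y = x
  · rw [h, pt_self]
    exact zero_le_one
  · rw [pt_of_ne h]

variable {F : Type*} [Field F] {W : WeierstrassCurve.Affine F} [IsAlgClosed F] [W.IsElliptic]

/-- Scale `u` to take the value `1` at `p₁`. Then `1 - y` vanishes at `p₁` and has poles bounded by
`Dinf`, of degree two, which leaves exactly one further zero `t`. -/
lemma exists_pencil_of_divisorOf_eq {D₀ Dinf : W.Point →₀ ℤ} {p₁ : W.Point}
    (hD : 0 ≤ Dinf) (hD₀ : 0 ≤ D₀) (h0 : D₀ p₁ = 0) (hinf : Dinf p₁ = 0)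
    (hdeg : divisorDegree Dinf = 2) (hne : D₀ ≠ Dinf) {u : W.FunctionFieldˣ}
    (hu : divisorOf u = D₀ - Dinf) : ∃ (y y' : W.FunctionFieldˣ) (t : W.Point),
      (y : W.FunctionField) + y' = 1 ∧ divisorOf y = D₀ - Dinf ∧
        divisorOf y' = pt p₁ + pt t - Dinf := by
  obtain ⟨c, hc0, hc⟩ := exists_lt_divisorOf_sub (f := u) (g := 1) (P := p₁)
    (by rw [hu, divisorOf_one, Finsupp.sub_apply, h0, hinf]; rfl)
  obtain ⟨h, hh⟩ := exists_unit_eq_sub_smul (f := u) (g := 1)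
    (by rw [hu, divisorOf_one]; exact sub_ne_zero.mpr hne) c
  have hpos := hc h hh
  rw [divisorOf_one, Finsupp.zero_apply] at hpos
  have hle : pt p₁ - Dinf ≤ divisorOf h := fun P => by
    rw [Finsupp.sub_apply]
    by_cases hP : P = p₁
    · rw [hP, pt_self, hinf]
      omega
    · have := min_le_divisorOf (f := u) (g := 1) (h := h) (a := 1) (b := -c)
        (by rw [hh]; simp [sub_eq_add_neg]) P
      rw [hu, divisorOf_one, Finsupp.zero_apply, Finsupp.sub_apply] at this
      rw [pt_of_ne hP]
      have := hD P
      have := hD₀ P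
      simp only [Finsupp.zero_apply] at *
      omega
  obtain ⟨t, ht⟩ := exists_eq_add_single hle (by
    rw [map_sub, divisorDegree_divisorOf, divisorDegree_single, hdeg]
    norm_num)
  have hy : c⁻¹ • (u : W.FunctionField) ≠ 0 := smul_ne_zero (inv_ne_zero hc0) u.ne_zero
  have hy' : (-c⁻¹) • (h : W.FunctionField) ≠ 0 :=
    smul_ne_zero (neg_ne_zero.mpr (inv_ne_zero hc0)) h.ne_zero
  refine ⟨Units.mk0 _ hy, Units.mk0 _ hy', t, ?_, ?_, ?_⟩
  · rw [Units.val_mk0, Units.val_mk0, hh, smul_sub, smul_smul, Units.val_one, neg_mul,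
      inv_mul_cancel₀ hc0]
    module
  · rw [divisorOf_eq_of_eq_smul (Units.val_mk0 hy), hu]
  · rw [divisorOf_eq_of_eq_smul (Units.val_mk0 hy'), ht]
    abel

variable [DecidableEq F]

lemma exists_pencil_of_add_eq_add {p₀ q₀ p₁ q₁ p q : W.Point}
    (h01 : ∀ P, (pt p₀ + pt q₀) P = 0 ∨ (pt p₁ + pt q₁) P = 0)
    (h0 : ∀ P, (pt p₀ + pt q₀) P = 0 ∨ (pt p + pt q) P = 0)
    (h1 : ∀ P, (pt p₁ + pt q₁) P = 0 ∨ (pt p + pt q) P = 0) (hadd : p₀ + q₀ = p + q) :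
    ∃ (y y' : W.FunctionFieldˣ) (t t' r : W.Point), (y : W.FunctionField) + y' = 1 ∧
      divisorOf y = pt p₀ + pt q₀ + pt t - (pt p + pt q + pt r) ∧
      divisorOf y' = pt p₁ + pt q₁ + pt t' - (pt p + pt q + pt r) := by
  have hpt : ∀ x : W.Point, 0 ≤ pt x := fun x P => pt_nonneg x P
  have hp₁ : (pt p₁ + pt q₁) p₁ ≠ 0 := by
    rw [Finsupp.add_apply, pt_self]
    have := pt_nonneg q₁ p₁
    omega
  obtain ⟨u, hu⟩ := exists_divisor_eq hadd
  obtain ⟨y, y', t, hy, hdy, hdy'⟩ := exists_pencil_of_divisorOf_eq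
    (add_nonneg (hpt p) (hpt q)) (add_nonneg (hpt p₀) (hpt q₀)) ((h01 p₁).resolve_right hp₁)
    ((h1 p₁).resolve_left hp₁) (by rw [map_add, divisorDegree_single, divisorDegree_single]; rfl)
    (fun h => by
      have := h0 p₀
      rw [← h, or_self, Finsupp.add_apply, pt_self] at this
      have := pt_nonneg q₀ p₀
      omega) hu
  -- The degree-two pencil already suffices; adding `q₁` to both zeros and poles brings it to the
  -- required form.
  refine ⟨y, y', q₁, t, q₁, hy, ?_, ?_⟩
  · rw [hdy]
    abel
  · rw [hdy']
    abel

/-- The zeros do not cancel the poles: `p` is not one of `p₀`, `q₀`, and if `s` were one of them,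
the sum relation would make `p` the other. -/
lemma divisorOf_apply_of_disjoint {p₀ q₀ p s P : W.Point} {u : W.FunctionFieldˣ}
    (hadd : p + s = p₀ + q₀)
    (hu : divisorOf u = pt p + pt s - (pt p₀ + pt q₀)) (hp : (pt p₀ + pt q₀) p = 0)
    (hP : 0 < (pt p₀ + pt q₀) P) : divisorOf u P = -(pt p₀ + pt q₀) P := by
  have hne : ∀ {a b : W.Point}, pt a b = 0 → b ≠ a := by
    rintro a b h rfl
    rw [pt_self] at h
    exact one_ne_zero h
  have h1 := pt_nonneg p₀ p
  have h2 := pt_nonneg q₀ p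
  have h3 : pt p P = 0 := by
    refine pt_of_ne ?_
    rintro rfl
    omega
  have h4 : pt s P = 0 := by
    refine pt_of_ne ?_
    rintro rfl
    rw [Finsupp.add_apply] at hp hP
    by_cases hs : P = p₀
    · subst hs
      rw [add_comm, add_right_inj] at hadd
      exact hne (a := q₀) (by omega) hadd
    · by_cases hs' : P = q₀
      · subst hs'
        rw [add_left_inj] at hadd
        exact hne (a := p₀) (by omega) hadd
      · rw [pt_of_ne hs, pt_of_ne hs'] at hP
        omega
  rw [hu, Finsupp.sub_apply, Finsupp.add_apply (pt p), h3, h4]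
  ring

/-- Write `D₀ = p₀ + q₀` and `D₁ = p₁ + q₁`. Generically, combine `u₀` (poles `D₀`) and `u₁` (poles
`D₁`), both vanishing at `p`, into `z` vanishing on `p + q`. Splitting `z` as `w + v`, with `w`
having poles only in `D₁` and `v` only in `D₀`, and dividing by `z` gives the pencil. The excluded
cases, where `D₀` or `D₁` has the same sum as `p + q`, come from a degree-two function. -/
lemma exists_pencil {p₀ q₀ p₁ q₁ p q : W.Point}
    (h01 : ∀ P, (pt p₀ + pt q₀) P = 0 ∨ (pt p₁ + pt q₁) P = 0)
    (h0 : ∀ P, (pt p₀ + pt q₀) P = 0 ∨ (pt p + pt q) P = 0)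
    (h1 : ∀ P, (pt p₁ + pt q₁) P = 0 ∨ (pt p + pt q) P = 0) :
    ∃ (y y' : W.FunctionFieldˣ) (t t' r : W.Point), (y : W.FunctionField) + y' = 1 ∧
      divisorOf y = pt p₀ + pt q₀ + pt t - (pt p + pt q + pt r) ∧
      divisorOf y' = pt p₁ + pt q₁ + pt t' - (pt p + pt q + pt r) := by
  by_cases hs₀ : p₀ + q₀ = p + q
  · exact exists_pencil_of_add_eq_add h01 h0 h1 hs₀
  by_cases hs₁ : p₁ + q₁ = p + q
  · obtain ⟨y, y', t, t', r, hy, hdy, hdy'⟩ :=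
      exists_pencil_of_add_eq_add (fun P => (h01 P).symm) h1 h0 hs₁
    exact ⟨y', y, t', t, r, by rw [add_comm, hy], hdy', hdy⟩
  obtain ⟨s₀, hadd₀⟩ : ∃ s, p + s = p₀ + q₀ := ⟨p₀ + q₀ - p, by abel⟩
  obtain ⟨s₁, hadd₁⟩ : ∃ s, p + s = p₁ + q₁ := ⟨p₁ + q₁ - p, by abel⟩
  -- The second zero of `u₀`, and likewise of `u₁`, avoids `q`. Both functions then have the same
  -- order at `q` (`1` if `q = p`, else `0`), so a combination gains a zero there.
  replace hs₀ : q ≠ s₀ := fun h => hs₀ (by rw [h, hadd₀])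
  replace hs₁ : q ≠ s₁ := fun h => hs₁ (by rw [h, hadd₁])
  obtain ⟨u₀, hu₀⟩ : ∃ u₀ : W.FunctionFieldˣ, divisorOf u₀ =
      pt p + pt s₀ - (pt p₀ + pt q₀) := exists_divisor_eq hadd₀
  obtain ⟨u₁, hu₁⟩ : ∃ u₁ : W.FunctionFieldˣ, divisorOf u₁ =
      pt p + pt s₁ - (pt p₁ + pt q₁) := exists_divisor_eq hadd₁
  have hD₀ : ∀ P, 0 ≤ (pt p₀ + pt q₀) P := fun P => add_nonneg (pt_nonneg _ _) (pt_nonneg _ _)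
  have hD₁ : ∀ P, 0 ≤ (pt p₁ + pt q₁) P := fun P => add_nonneg (pt_nonneg _ _) (pt_nonneg _ _)
  have hp₀ : 0 < (pt p₀ + pt q₀) p₀ := by
    rw [Finsupp.add_apply, pt_self]
    have := pt_nonneg q₀ p₀
    omega
  have hp₁ : 0 < (pt p₁ + pt q₁) p₁ := by
    rw [Finsupp.add_apply, pt_self]
    have := pt_nonneg q₁ p₁
    omega
  have hp : (pt p + pt q) p ≠ 0 := by
    rw [Finsupp.add_apply, pt_self]
    have := pt_nonneg q p
    omega
  have hq : (pt p + pt q) q ≠ 0 := by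
    rw [Finsupp.add_apply, pt_self]
    have := pt_nonneg p q
    omega
  have hdeg : ∀ x y : W.Point, divisorDegree (pt x + pt y) = 2 := fun x y => by
    rw [map_add, divisorDegree_single, divisorDegree_single]
    rfl
  have hpole₀ : ∀ P, 0 < (pt p₀ + pt q₀) P → divisorOf u₀ P = -(pt p₀ + pt q₀) P := fun P =>
    divisorOf_apply_of_disjoint hadd₀ hu₀ ((h0 p).resolve_right hp)
  have hpole₁ : ∀ P, 0 < (pt p₁ + pt q₁) P → divisorOf u₁ P = -(pt p₁ + pt q₁) P := fun P =>
    divisorOf_apply_of_disjoint hadd₁ hu₁ ((h1 p).resolve_right hp)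
  have hge₀ : ∀ P, pt p P - (pt p₀ + pt q₀) P ≤ divisorOf u₀ P := fun P => by
    rw [hu₀, Finsupp.sub_apply, Finsupp.add_apply (pt p)]
    have := pt_nonneg s₀ P
    omega
  have hge₁ : ∀ P, pt p P - (pt p₁ + pt q₁) P ≤ divisorOf u₁ P := fun P => by
    rw [hu₁, Finsupp.sub_apply, Finsupp.add_apply (pt p)]
    have := pt_nonneg s₁ P
    omega
  have huq₀ : divisorOf u₀ q = pt p q := by
    rw [hu₀, Finsupp.sub_apply, Finsupp.add_apply (pt p), pt_of_ne hs₀,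
      (h0 q).resolve_right hq]
    ring
  have huq₁ : divisorOf u₁ q = pt p q := by
    rw [hu₁, Finsupp.sub_apply, Finsupp.add_apply (pt p), pt_of_ne hs₁,
      (h1 q).resolve_right hq]
    ring
  have hne : divisorOf u₁ ≠ divisorOf u₀ := fun h => by
    have h2 := hpole₀ p₀ hp₀
    have h3 := hge₁ p₀
    rw [(h01 p₀).resolve_left hp₀.ne', h] at h3
    have := pt_nonneg p p₀
    omega
  obtain ⟨c, hc0, hc⟩ := exists_lt_divisorOf_sub (huq₁.trans huq₀.symm)
  obtain ⟨z, hz⟩ := exists_unit_eq_sub_smul hne c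
  have hzq := hc z hz
  have hz₁ : ∀ P, min (divisorOf u₁ P) (divisorOf u₀ P) ≤ divisorOf z P :=
    min_le_divisorOf (a := 1) (b := -c) (by rw [hz]; module)
  have hz₂ : ∀ P, min (divisorOf u₁ P) (divisorOf z P) ≤ divisorOf u₀ P :=
    min_le_divisorOf (a := c⁻¹) (b := -c⁻¹) (by
      rw [hz, smul_sub, smul_smul, neg_mul, inv_mul_cancel₀ hc0]
      module)
  have hz₃ : ∀ P, min (divisorOf u₀ P) (divisorOf z P) ≤ divisorOf u₁ P :=
    min_le_divisorOf (a := c) (b := 1) (by rw [hz]; module)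
  have hzle : pt p + pt q - (pt p₀ + pt q₀) - (pt p₁ + pt q₁) ≤ divisorOf z := fun P => by
    rw [Finsupp.sub_apply, Finsupp.sub_apply, Finsupp.add_apply (pt p)]
    have h2 := hD₀ P
    have h3 := hD₁ P
    by_cases hP : P = q
    · subst hP
      rw [pt_self]
      omega
    · rw [pt_of_ne hP]
      have h4 := hz₁ P
      have h5 := hge₀ P
      have h6 := hge₁ P
      omega
  -- The lower bound has degree `2 - 2 - 2 = -2`, so `z` has two further zeros; one will be
  -- cancelled in the quotients by `z`, the other becomes the third pole.
  obtain ⟨r, r', hr⟩ := exists_eq_add_single_add_single hzle (by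
    rw [map_sub, map_sub, divisorDegree_divisorOf, hdeg, hdeg, hdeg]
    norm_num)
  have hzP : ∀ P, divisorOf z P = (pt p + pt q) P - (pt p₀ + pt q₀) P - (pt p₁ + pt q₁) P +
      pt r P + pt r' P := fun P => by
    rw [hr]
    rfl
  have hDr : 0 ≤ (pt p + pt q) r := add_nonneg (pt_nonneg _ _) (pt_nonneg _ _)
  have hzr := hzP r
  rw [pt_self] at hzr
  have hr'r := pt_nonneg r' r
  have hpr := pt_nonneg p r
  -- At a point of `D₀`, `u₁` is regular and `u₀` has a pole of full order `D₀`, so `z` has that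
  -- same pole; an extra zero `r` there would lower its order.
  have hr₀ : (pt p₀ + pt q₀) r = 0 := by
    by_contra hcon
    have := hpole₀ r (lt_of_le_of_ne (hD₀ r) (Ne.symm hcon))
    have := hge₁ r
    have := hz₂ r
    have := hD₀ r
    have := h01 r
    omega
  have hr₁ : (pt p₁ + pt q₁) r = 0 := by
    by_contra hcon
    have := hpole₁ r (lt_of_le_of_ne (hD₁ r) (Ne.symm hcon))
    have := hge₀ r
    have := hz₃ r
    have := hD₁ r
    omega
  have hu₁r := hge₁ r
  -- As `r` lies off `D₁`, `u₁` has a value `a` at `r`, and `w = u₁ - a` vanishes there.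
  obtain ⟨a, ha⟩ := exists_divisorOf_sub_pos (f := u₁) (P := r) (by omega)
  obtain ⟨w, hw⟩ := exists_unit_eq_sub_smul (f := u₁) (g := 1) (fun h => by
    have := hpole₁ p₁ hp₁
    rw [h, divisorOf_one, Finsupp.zero_apply] at this
    omega) a
  have hwr := ha w hw
  rw [Units.val_one] at hw
  have hwle : pt r - (pt p₁ + pt q₁) ≤ divisorOf w := fun P => by
    rw [Finsupp.sub_apply]
    by_cases hP : P = r
    · subst hP
      rw [pt_self]
      omega
    · rw [pt_of_ne hP]
      have h2 := min_le_divisorOf (f := u₁) (g := 1) (h := w) (a := 1) (b := -a)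
        (by rw [hw, Units.val_one]; module) P
      rw [divisorOf_one, Finsupp.zero_apply] at h2
      have h3 := hge₁ P
      have h4 := hD₁ P
      have h5 := pt_nonneg p P
      omega
  obtain ⟨t, ht⟩ := exists_eq_add_single hwle (by
    rw [map_sub, divisorDegree_divisorOf, hdeg, divisorDegree_single]
    norm_num)
  obtain ⟨v, hv⟩ := exists_unit_eq_sub_smul (f := z) (g := w) (fun h => by
    have h2 := hz₁ p₀
    have h3 := hz₂ p₀
    have h4 := hpole₀ p₀ hp₀
    have h5 := hge₁ p₀
    rw [h] at h3
    have h6 := hwle p₀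
    have h7 := pt_nonneg r p₀
    have h8 := pt_nonneg p p₀
    rw [Finsupp.sub_apply] at h6
    have h9 := (h01 p₀).resolve_left hp₀.ne'
    omega) 1
  rw [one_smul] at hv
  -- Since `v = z - w = a - c u₀`, its poles lie in `D₀`; it vanishes at `r` because `z` and `w` do.
  have hvle : pt r - (pt p₀ + pt q₀) ≤ divisorOf v := fun P => by
    rw [Finsupp.sub_apply]
    by_cases hP : P = r
    · subst hP
      have := min_le_divisorOf (f := z) (g := w) (h := v) (a := 1) (b := -1)
        (by rw [hv]; module) P
      rw [pt_self]
      omega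
    · rw [pt_of_ne hP]
      have h2 := min_le_divisorOf (f := 1) (g := u₀) (h := v) (a := a) (b := -c)
        (by rw [hv, hw, hz, Units.val_one]; module) P
      rw [divisorOf_one, Finsupp.zero_apply] at h2
      have h3 := hge₀ P
      have h4 := hD₀ P
      have h5 := pt_nonneg p P
      omega
  obtain ⟨t', ht'⟩ := exists_eq_add_single hvle (by
    rw [map_sub, divisorDegree_divisorOf, hdeg, divisorDegree_single]
    norm_num)
  refine ⟨w / z, v / z, t, t', r', ?_, ?_, ?_⟩
  · rw [Units.val_div_eq_div_val, Units.val_div_eq_div_val, ← add_div, hv, add_sub_cancel,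
      div_self z.ne_zero]
  · rw [divisorOf_div, ht, hr]
    abel
  · rw [divisorOf_div, ht', hr]
    abel

end Pencil

/-! ### Five-term relation and descent on the degree -/

section Bloch

variable {F : Type*} [Field F] {W : WeierstrassCurve.Affine F} [IsAlgClosed F] [W.IsElliptic]

/-- The ultrametric inequality for each of the three functions `f`, `g`, `1` in terms of the other
two. It makes the zeros of `f`, the zeros of `g` and the poles disjoint, and the poles of `f` and
`g` equal. -/
lemma divisorOf_trichotomy {f g : W.FunctionFieldˣ} (h : (f : W.FunctionField) + g = 1)
    (P : W.Point) : min (divisorOf f P) (divisorOf g P) ≤ 0 ∧ min (divisorOf f P) 0 ≤ divisorOf g P ∧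
      min (divisorOf g P) 0 ≤ divisorOf f P := by
  have h1 := min_le_divisorOf (f := f) (g := g) (h := 1) (a := 1) (b := 1) (by simp [h]) P
  have h2 := min_le_divisorOf (f := f) (g := 1) (h := g) (a := -1) (b := 1) (by simp [← h]) P
  have h3 := min_le_divisorOf (f := g) (g := 1) (h := f) (a := -1) (b := 1) (by simp [← h]) P
  rw [divisorOf_one, Finsupp.zero_apply] at h1 h2 h3
  exact ⟨h1, h2, h3⟩

variable [DecidableEq F]

/-- The element `β (f ∧ g)` of `ℤ[E]⁻`. -/
noncomputable def symbol (f g : W.FunctionFieldˣ) : MinusGroup W.Point := beta (wedge f g)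

lemma symbol_mul_left (f f' g : W.FunctionFieldˣ) :
    symbol (f * f') g = symbol f g + symbol f' g := by
  simp only [symbol, beta_wedge, ofMul_mul, map_add, diffPairing_add_left]

lemma symbol_div_left (f f' g : W.FunctionFieldˣ) :
    symbol (f / f') g = symbol f g - symbol f' g := by
  rw [eq_sub_iff_add_eq, ← symbol_mul_left, div_mul_cancel]

lemma symbol_swap (f g : W.FunctionFieldˣ) : symbol g f = -symbol f g := by
  rw [symbol, symbol, beta_wedge, beta_wedge, diffPairing_neg_swap]

lemma symbol_self (f : W.FunctionFieldˣ) : symbol f f = 0 := by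
  rw [symbol, beta_wedge, diffPairing_self, divisorDegree_divisor, zero_smul]

lemma symbol_div_right (f g g' : W.FunctionFieldˣ) :
    symbol f (g / g') = symbol f g - symbol f g' := by
  rw [symbol_swap, symbol_div_left, symbol_swap f g, symbol_swap f g']
  abel

lemma symbol_mul_right (f g g' : W.FunctionFieldˣ) :
    symbol f (g * g') = symbol f g + symbol f g' := by
  rw [symbol_swap, symbol_mul_left, symbol_swap f g, symbol_swap f g']
  abel

/-- The five-term relation. -/
lemma symbol_five_term (x x' y y' d : W.FunctionFieldˣ) :
    symbol x x' = symbol y y' - symbol (y / x) (d / x) +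
      symbol (x' * y / (x * y')) (d / (x * y')) - symbol (x' / y') (d / y') := by
  simp only [symbol_div_left, symbol_div_right, symbol_mul_left, symbol_mul_right, symbol_self]
  rw [symbol_swap x x', symbol_swap x y, symbol_swap x y']
  abel

lemma blochRelation_eq {f : W.FunctionField} (h0 : f ≠ 0) (h1 : f ≠ 1) {u v : W.FunctionFieldˣ}
    (hu : (u : W.FunctionField) = f) (hv : (u : W.FunctionField) + v = 1) :
    blochRelation f h0 h1 = symbol u v := by
  subst hu
  obtain rfl : v = Units.mk0 (1 - (u : W.FunctionField)) (sub_ne_zero.mpr h1.symm) :=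
    Units.ext (by rw [Units.val_mk0, ← hv]; ring)
  rw [blochRelation, symbol, Units.mk0_val]

/-- The subgroup generated by the relations of functions of degree at most three. -/
noncomputable def cubicBlochGroup (W : WeierstrassCurve.Affine F) [W.IsElliptic] :
    AddSubgroup (MinusGroup W.Point) :=
  AddSubgroup.closure {z | ∃ (f : W.FunctionField) (h0 : f ≠ 0) (h1 : f ≠ 1),
    functionDegree (Units.mk0 f h0) ≤ 3 ∧ z = blochRelation f h0 h1}

lemma symbol_mem_of_functionDegree_le {u v : W.FunctionFieldˣ} (h : (u : W.FunctionField) + v = 1)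
    (hu : functionDegree u ≤ 3) : symbol u v ∈ cubicBlochGroup W := by
  have h1 : (u : W.FunctionField) ≠ 1 := fun h1 => v.ne_zero (by simp [h1] at h)
  refine AddSubgroup.subset_closure ⟨u, u.ne_zero, h1, ?_, (blochRelation_eq _ _ rfl h).symm⟩
  rwa [Units.mk0_val]

lemma symbol_mem_cubicBlochGroup {u v : W.FunctionFieldˣ} (h : (u : W.FunctionField) + v = 1) :
    symbol u v ∈ cubicBlochGroup W := by
  induction hn : functionDegree u using Nat.strong_induction_on generalizing u v with
  | h n ih =>
    by_cases h3 : functionDegree u ≤ 3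
    · exact symbol_mem_of_functionDegree_le h h3
    have hdeg := functionDegree_eq u
    set Z₀ := divisorOf u ⊔ 0 with hZ₀
    set Z₁ := divisorOf v ⊔ 0 with hZ₁
    set Z := (-divisorOf u) ⊔ 0 with hZ
    have hZ₀0 : 0 ≤ Z₀ := le_sup_right
    have hZ₁0 : 0 ≤ Z₁ := le_sup_right
    have hZ0 : 0 ≤ Z := le_sup_right
    have hu : divisorOf u = Z₀ - Z := by
      ext P
      simp only [hZ₀, hZ, Finsupp.sub_apply, Finsupp.sup_apply, Finsupp.neg_apply,
        Finsupp.zero_apply]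
      omega
    have hv : divisorOf v = Z₁ - Z := by
      ext P
      have := divisorOf_trichotomy h P
      simp only [hZ₁, hZ, Finsupp.sub_apply, Finsupp.sup_apply, Finsupp.neg_apply,
        Finsupp.zero_apply]
      omega
    have hdZ : divisorDegree Z₀ = divisorDegree Z := by
      have := divisorDegree_divisorOf u
      rw [hu, map_sub] at this
      omega
    have hdZ₁ : divisorDegree Z₁ = divisorDegree Z := by
      have := divisorDegree_divisorOf v
      rw [hv, map_sub] at this
      omega
    obtain ⟨p₀, q₀, hpq₀⟩ := exists_single_add_single_le hZ₀0 (by omega)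
    obtain ⟨p₁, q₁, hpq₁⟩ := exists_single_add_single_le hZ₁0 (by omega)
    obtain ⟨p, q, hpq⟩ := exists_single_add_single_le hZ0 (by omega)
    have hle : ∀ P, (0 ≤ (pt p₀ + pt q₀) P ∧ (pt p₀ + pt q₀) P ≤ Z₀ P) ∧
        (0 ≤ (pt p₁ + pt q₁) P ∧ (pt p₁ + pt q₁) P ≤ Z₁ P) ∧
        (0 ≤ (pt p + pt q) P ∧ (pt p + pt q) P ≤ Z P) := fun P =>
      ⟨⟨add_nonneg (pt_nonneg _ _) (pt_nonneg _ _), hpq₀ P⟩,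
        ⟨add_nonneg (pt_nonneg _ _) (pt_nonneg _ _), hpq₁ P⟩,
        ⟨add_nonneg (pt_nonneg _ _) (pt_nonneg _ _), hpq P⟩⟩
    have hdisj : ∀ P, (Z₀ P = 0 ∨ Z₁ P = 0) ∧ (Z₀ P = 0 ∨ Z P = 0) ∧ (Z₁ P = 0 ∨ Z P = 0) := by
      intro P
      have := divisorOf_trichotomy h P
      simp only [hZ₀, hZ₁, hZ, Finsupp.sup_apply, Finsupp.neg_apply, Finsupp.zero_apply]
      omega
    obtain ⟨y, y', t, t', r, hy, hdy, hdy'⟩ := exists_pencil (W := W) (p₀ := p₀) (q₀ := q₀)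
      (p₁ := p₁) (q₁ := q₁) (p := p) (q := q)
      (fun P => by have := hle P; have := hdisj P; omega)
      (fun P => by have := hle P; have := hdisj P; omega)
      (fun P => by have := hle P; have := hdisj P; omega)
    have hpt : ∀ x : W.Point, 0 ≤ pt x := fun x P => pt_nonneg x P
    have hdpt : ∀ x : W.Point, divisorDegree (pt x) = 1 := fun x => divisorDegree_single x 1
    have hydeg : functionDegree y ≤ 3 := by
      have := functionDegree_le (add_nonneg (add_nonneg (hpt p₀) (hpt q₀)) (hpt t))
        (add_nonneg (add_nonneg (hpt p) (hpt q)) (hpt r)) hdy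
      simp only [map_add, hdpt] at this
      omega
    -- The five-term relation needs `u ≠ y`, which holds because `deg y ≤ 3 < deg u`.
    have huy : (u : W.FunctionField) - y ≠ 0 := fun h0 => by
      rw [sub_eq_zero] at h0
      rw [Units.ext h0] at h3
      exact h3 hydeg
    -- Each quotient below has zeros bounded by `A`: one of `Z`, `Z₁` less two chosen points plus
    -- one new point, hence of degree `n - 1`.
    have hreduce : ∀ {A B : W.Point →₀ ℤ} {f g : W.FunctionFieldˣ}, 0 ≤ A → 0 ≤ B →
        divisorOf f = A - B → divisorDegree A = divisorDegree Z - 1 →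
        (f : W.FunctionField) + g = 1 → symbol f g ∈ cubicBlochGroup W := by
      intro A B f g hA hB hf hdA hfg
      have := functionDegree_le hA hB hf
      exact ih _ (by omega) hfg rfl
    have hx := u.ne_zero
    have hy0 := y'.ne_zero
    have hu' : (v : W.FunctionField) = 1 - u := by rw [← h]; ring
    have hyy : (y' : W.FunctionField) = 1 - y := by rw [← hy]; ring
    rw [symbol_five_term u v y y' (Units.mk0 _ huy)]
    refine sub_mem (add_mem (sub_mem (symbol_mem_of_functionDegree_le hy hydeg) ?_) ?_) ?_
    · refine hreduce (A := Z - (pt p + pt q) + pt t) (B := Z₀ - (pt p₀ + pt q₀) + pt r)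
        (add_nonneg (sub_nonneg.mpr hpq) (hpt _)) (add_nonneg (sub_nonneg.mpr hpq₀) (hpt _))
        ?_ ?_ ?_
      · rw [divisorOf_div, hdy, hu]
        abel
      · simp only [map_add, map_sub, hdpt]
        ring
      · simp only [Units.val_div_eq_div_val, Units.val_mk0]
        field_simp
        ring
    · refine hreduce (A := Z₁ - (pt p₁ + pt q₁) + pt t) (B := Z₀ - (pt p₀ + pt q₀) + pt t')
        (add_nonneg (sub_nonneg.mpr hpq₁) (hpt _)) (add_nonneg (sub_nonneg.mpr hpq₀) (hpt _))
        ?_ ?_ ?_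
      · rw [divisorOf_div, divisorOf_mul, divisorOf_mul, hdy, hdy', hu, hv]
        abel
      · simp only [map_add, map_sub, hdpt]
        omega
      · simp only [Units.val_div_eq_div_val, Units.val_mk0, Units.val_mul, hu']
        rw [← add_div, div_eq_one_iff_eq (mul_ne_zero hx hy0), hyy]
        ring
    · refine hreduce (A := Z₁ - (pt p₁ + pt q₁) + pt r) (B := Z - (pt p + pt q) + pt t')
        (add_nonneg (sub_nonneg.mpr hpq₁) (hpt _)) (add_nonneg (sub_nonneg.mpr hpq) (hpt _))
        ?_ ?_ ?_
      · rw [divisorOf_div, hdy', hv]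
        abel
      · simp only [map_add, map_sub, hdpt]
        omega
      · simp only [Units.val_div_eq_div_val, Units.val_mk0, hu']
        rw [← add_div, div_eq_one_iff_eq hy0, hyy]
        ring

end Bloch
end EllipticBloch

theorem mainTheorem3 {k : Type*} [Field k] [IsAlgClosed k] [CharZero k] [DecidableEq k]
    (E : WeierstrassCurve.Affine k) [WeierstrassCurve.IsElliptic E] :
    EllipticBloch.blochGroup E =
      AddSubgroup.closure {z | ∃ (f : E.FunctionField) (h0 : f ≠ 0) (h1 : f ≠ 1),
        EllipticBloch.functionDegree (Units.mk0 f h0) ≤ 3 ∧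
          z = EllipticBloch.blochRelation f h0 h1} := by
  refine le_antisymm ((AddSubgroup.closure_le _).mpr ?_) (AddSubgroup.closure_mono ?_)
  · rintro _ ⟨f, h0, h1, rfl⟩
    exact EllipticBloch.symbol_mem_cubicBlochGroup (u := Units.mk0 f h0)
      (v := Units.mk0 (1 - f) (sub_ne_zero.mpr h1.symm)) (by simp)
  · rintro _ ⟨f, h0, h1, -, rfl⟩
    exact ⟨f, h0, h1, rfl⟩
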